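/- A geometry is a set $X$ of points with a family of subsets, called subspaces, that contains $\emptyset$, $X$ and all one-point sets, is closed under arbitrary intersections, and satisfies two axioms, in which $\overline{A}$ denotes the least subspace containing $A\subseteq X$. Exchange: if $S$ is a subspace and $x\notin S$, no subspace lies strictly between $S$ and $\overline{S\cup\{x\}}$. Finitary: if $x\in\overline{A}$ then $x\in\overline{B}$ for some finite $B\subseteq A$. A basis of a subspace $S$ is a set $B$ with $\overline{B}=S$ and $b\notin\overline{B\setminus\{b\}}$ for all $b\in B$; the dimension of $S$ is the cardinal of its bases minus $1$. Lines and planes are the subspaces of dimension $1$ and $2$. A subset $A\subseteq X$ is a geometry (a subgeometry) with subspaces $S\cap A$, for $S$ a subspace of $X$. A morphism of geometries is a map under which preimages of subspaces are subspaces; an isomorphism is a bijective morphism whose inverse is a morphism; a morphism $f\colon X\to X'$ is an embedding if $X\to f(X)$ is an isomorphism onto the subgeometry $f(X)$. For $x\in X$, the quotient $X/x$ is the set of classes $[y]$ of points $y\ne x$, where $[y]=[z]$ iff $\overline{\{y,x\}}=\overline{\{z,x\}}$; if $X$ is a subgeometry of $Y$ and $x\in X$ then $X/x\subseteq Y/x$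 via $[y]\mapsto[y]$. A geometry has enough points if its dimension is at least $2$ and every plane of it contains four points, no three of which are collinear. Let $V$ and $V'$ be left vector spaces over division rings $K$ and $K'$, and let $\mathbb{P}=\mathbb{P}(V)$ and $\mathbb{P}'=\mathbb{P}(V')$, regarded as geometries whose subspaces are the sets $\mathbb{P}(W)$ for vector subspaces $W$. A semilinear map $\Phi\colon V\to V'$ is an additive map with $\Phi(\lambda v)=\sigma(\lambda)\Phi(v)$ for some ring morphism $\sigma\colon K\to K'$ (not necessarily surjective); it induces the partial map $\mathbb{P}\dashrightarrow\mathbb{P}'$, $\langle v\rangle\mapsto\langle\Phi(v)\rangle$, defined on the complement of $\mathbb{P}(\ker\Phi)$. The partial maps obtained in this way are called partial projective morphisms. **Theorem.** Let $X\subseteq\mathbb{P}$ be a subgeometry with enough points, and let $\varphi\colon X\to\mathbb{P}'$ be a morphism of geometries such that 1. the image of $\varphi$ is not contained in a subspace of $\mathbb{P}'$ of dimension $\le 2$; 2. there are $x_1,x_2\in X$ with $X/x_i=\mathbb{P}/x_i$ for $i=1,2$ and $\varphi(x_1)\ne\varphi(x_2)$. Then there is a unique partial projective morphism $\phi\colon\mathbb{P}\dashrightarrow\mathbb{P}'$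 that is defined at every point of $X$ and satisfies $\phi|_X=\varphi$. Moreover: (a) if $\varphi$ is injective, then $\phi$ is defined on all of $\mathbb{P}$; (b) if $\varphi$ is an embedding of geometries, then $\phi$ is defined on all of $\mathbb{P}$ and $\phi\colon\mathbb{P}\to\mathbb{P}'$ is an embedding of geometries. -/

import Mathlib

open scoped LinearAlgebra.Projectivization

/-- The least member of the family `F` of subsets of `X` containing `A`
(when `F` is stable under intersections): the intersection of all members containing `A`. -/
def flatClosure {X : Type*} (F : Set (Set X)) (A : Set X) : Set X :=
  ⋂₀ {T | T ∈ F ∧ A ⊆ T}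

/-- A geometry: a set of points with a family of subspaces (flats) which contains the empty set,
the whole set and the points, is stable under intersections, and satisfies the exchange axiom and
the finitary axiom. -/
structure PointGeometry (X : Type*) where
  flats : Set (Set X)
  empty_mem : ∅ ∈ flats
  univ_mem : Set.univ ∈ flats
  singleton_mem : ∀ x : X, {x} ∈ flats
  sInter_mem : ∀ 𝒮 : Set (Set X), 𝒮 ⊆ flats → ⋂₀ 𝒮 ∈ flats
  exchange : ∀ S ∈ flats, ∀ x ∉ S,
    ¬ ∃ S' ∈ flats, S ⊂ S' ∧ S' ⊂ flatClosure flats (insert x S)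
  finitary : ∀ (A : Set X) (x : X), x ∈ flatClosure flats A →
    ∃ B : Set X, B.Finite ∧ B ⊆ A ∧ x ∈ flatClosure flats B

namespace PointGeometry

variable {X X' : Type*}

/-- The closure of a subset. -/
def cl (G : PointGeometry X) (A : Set X) : Set X := flatClosure G.flats A

theorem subset_cl (G : PointGeometry X) (A : Set X) : A ⊆ G.cl A :=
  fun _ ha _ hT => hT.2 ha

theorem cl_mem (G : PointGeometry X) (A : Set X) : G.cl A ∈ G.flats :=
  G.sInter_mem _ fun _ hT => hT.1

theorem cl_subset (G : PointGeometry X) {A S : Set X} (hS : S ∈ G.flats) (h : A ⊆ S) :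
    G.cl A ⊆ S :=
  fun _ hx => hx S ⟨hS, h⟩

theorem cl_mono (G : PointGeometry X) {A B : Set X} (h : A ⊆ B) : G.cl A ⊆ G.cl B :=
  G.cl_subset (G.cl_mem B) (h.trans (G.subset_cl B))

/-- `A` is independent when no `a ∈ A` lies in the closure of the other elements. -/
def Indep (G : PointGeometry X) (A : Set X) : Prop :=
  ∀ a ∈ A, a ∉ G.cl (A \ {a})

/-- `B` is a basis of the subspace `S`. -/
def IsBasis (G : PointGeometry X) (B S : Set X) : Prop :=
  G.Indep B ∧ G.cl B = S

/-- `S` is a subspace of dimension `n`: it has a basis with `n + 1` elements. -/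
def HasDim (G : PointGeometry X) (S : Set X) (n : ℕ) : Prop :=
  S ∈ G.flats ∧ ∃ B, G.IsBasis B S ∧ B.encard = n + 1

/-- Lines are the subspaces of dimension one. -/
def IsLine (G : PointGeometry X) (S : Set X) : Prop := G.HasDim S 1

/-- Planes are the subspaces of dimension two. -/
def IsPlane (G : PointGeometry X) (S : Set X) : Prop := G.HasDim S 2

/-- A geometry has enough points when its dimension is at least two and each of its planes has
four points, no three of which are collinear. -/
def EnoughPoints (G : PointGeometry X) : Prop :=
  (∃ B, G.IsBasis B Set.univ ∧ 3 ≤ B.encard) ∧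
  ∀ P, G.IsPlane P → ∃ Q ⊆ P, Q.encard = 4 ∧
    ∀ T ⊆ Q, T.encard = 3 → ¬ ∃ L, G.IsLine L ∧ T ⊆ L

/-- Morphisms of geometries: the preimage of a subspace is a subspace. -/
def IsMorphism (G : PointGeometry X) (G' : PointGeometry X') (f : X → X') : Prop :=
  ∀ S ∈ G'.flats, f ⁻¹' S ∈ G.flats

/-- Isomorphisms of geometries: bijective morphisms whose inverse is a morphism. -/
def IsIsomorphism (G : PointGeometry X) (G' : PointGeometry X') (f : X → X') : Prop :=
  G.IsMorphism G' f ∧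
  ∃ g : X' → X, Function.LeftInverse g f ∧ Function.RightInverse g f ∧ G'.IsMorphism G g

theorem cl_sub_aux (G : PointGeometry X) (A : Set X) (T : Set A) :
    flatClosure {T : Set A | ∃ S ∈ G.flats, T = Subtype.val ⁻¹' S} T =
      Subtype.val ⁻¹' G.cl (Subtype.val '' T) := by
  apply Set.Subset.antisymm
  · intro x hx
    exact hx _ ⟨⟨_, G.cl_mem _, rfl⟩, fun t ht => G.subset_cl _ ⟨t, ht, rfl⟩⟩
  · rintro x hx _ ⟨⟨S, hS, rfl⟩, hT⟩
    exact G.cl_subset hS (by rintro _ ⟨t, ht, rfl⟩; exact hT ht) hx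

/-- A subset `A` as a subgeometry: its subspaces are the sets `S ∩ A` with `S` a subspace. -/
def sub (G : PointGeometry X) (A : Set X) : PointGeometry A where
  flats := {T | ∃ S ∈ G.flats, T = Subtype.val ⁻¹' S}
  empty_mem := ⟨∅, G.empty_mem, rfl⟩
  univ_mem := ⟨Set.univ, G.univ_mem, rfl⟩
  singleton_mem x := ⟨{x.1}, G.singleton_mem x.1, by ext y; simp [Subtype.ext_iff]⟩
  sInter_mem 𝒮 h𝒮 := by
    refine ⟨⋂₀ {S | S ∈ G.flats ∧ Subtype.val ⁻¹' S ∈ 𝒮}, G.sInter_mem _ fun S hS => hS.1, ?_⟩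
    ext y
    constructor
    · rintro hy S ⟨_, hS⟩
      exact hy _ hS
    · intro hy T hT
      obtain ⟨S, hS, rfl⟩ := h𝒮 hT
      exact hy S ⟨hS, hT⟩
  exchange := by
    rintro T ⟨S, hS, rfl⟩ x hx ⟨T', ⟨S', hS', rfl⟩, h1, h2⟩
    rw [cl_sub_aux] at h2
    obtain ⟨y, hyS', hyS⟩ := Set.exists_of_ssubset h1
    set C := G.cl (Subtype.val '' (Subtype.val ⁻¹' S : Set A)) with hC
    have hCS : C ⊆ S := G.cl_subset hS (by rintro _ ⟨t, ht, rfl⟩; exact ht)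
    have hTC : Subtype.val '' (Subtype.val ⁻¹' S : Set A) ⊆ C := G.subset_cl _
    have hxC : x.1 ∉ C := fun h => hx (hCS h)
    have hyC : y.1 ∉ C := fun h => hyS (hCS h)
    have hle : G.cl (Subtype.val '' insert x (Subtype.val ⁻¹' S : Set A)) ⊆
        G.cl (insert x.1 C) := by
      apply G.cl_mono
      rw [Set.image_insert_eq]
      exact Set.insert_subset_insert hTC
    have hy2 : y.1 ∈ G.cl (insert x.1 C) := hle (h2.subset hyS')
    have hsub : G.cl (insert y.1 C) ⊆ G.cl (insert x.1 C) :=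
      G.cl_subset (G.cl_mem _) (Set.insert_subset hy2
        ((Set.subset_insert _ _).trans (G.subset_cl _)))
    have hx2 : x.1 ∈ G.cl (insert y.1 C) := by
      by_contra hne
      refine G.exchange C (G.cl_mem _) x.1 hxC ⟨G.cl (insert y.1 C), G.cl_mem _, ?_, ?_⟩
      · refine ⟨(Set.subset_insert _ _).trans (G.subset_cl _), fun h => hyC (h ?_)⟩
        exact G.subset_cl _ (Set.mem_insert _ _)
      · exact ⟨hsub, fun h => hne (h (G.subset_cl _ (Set.mem_insert _ _)))⟩
    have hTS' : Subtype.val '' (Subtype.val ⁻¹' S : Set A) ⊆ S' := by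
      rintro _ ⟨t, ht, rfl⟩; exact h1.subset ht
    have hxS' : x.1 ∈ S' :=
      G.cl_subset hS' (Set.insert_subset hyS' (G.cl_subset hS' hTS')) hx2
    refine h2.2 fun z hz => G.cl_subset hS' ?_ hz
    rw [Set.image_insert_eq]
    exact Set.insert_subset hxS' hTS'
  finitary := by
    intro T x hx
    rw [cl_sub_aux] at hx
    obtain ⟨B, hB, hBT, hxB⟩ := G.finitary _ _ hx
    refine ⟨Subtype.val ⁻¹' B, hB.preimage Subtype.val_injective.injOn, ?_, ?_⟩
    · intro b hb
      obtain ⟨t, ht, h⟩ := hBT hb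
      rwa [Subtype.val_injective h] at ht
    · rw [cl_sub_aux, Set.image_preimage_eq_of_subset]
      · exact hxB
      · intro b hb
        obtain ⟨t, _, rfl⟩ := hBT hb
        exact ⟨t, rfl⟩

theorem sub_cl (G : PointGeometry X) (A : Set X) (T : Set A) :
    (G.sub A).cl T = Subtype.val ⁻¹' G.cl (Subtype.val '' T) :=
  cl_sub_aux G A T

/-- Embeddings of geometries: morphisms `f` inducing an isomorphism of `X` onto the
subgeometry `f(X)` of `X'`. -/
def IsEmbedding (G : PointGeometry X) (G' : PointGeometry X') (f : X → X') : Prop :=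
  G.IsMorphism G' f ∧
  G.IsIsomorphism (G'.sub (Set.range f)) (Set.rangeFactorization f)

/-- The equivalence relation on `X - E` given by `x₁ ∨ E = x₂ ∨ E`. -/
def quotientSetoid (G : PointGeometry X) (E : Set X) : Setoid {x : X // x ∉ E} where
  r a b := G.cl (insert a.1 E) = G.cl (insert b.1 E)
  iseqv := ⟨fun _ => rfl, Eq.symm, Eq.trans⟩

/-- The points of the quotient `X / E`. -/
def Quot (G : PointGeometry X) (E : Set X) : Type _ := Quotient (G.quotientSetoid E)

/-- For `x ∈ A ⊆ X`, the canonical map `A / x → X / x`, `[y] ↦ [y]`. -/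
def subQuotMap (G : PointGeometry X) (A : Set X) (x : A) :
    (G.sub A).Quot {x} → G.Quot {x.1} :=
  Quotient.map (fun y => ⟨y.1.1, fun h => y.2 (Subtype.ext h)⟩) (by
    have key : ∀ a b : A, (G.sub A).cl {a, x} = (G.sub A).cl {b, x} →
        G.cl {a.1, x.1} ⊆ G.cl {b.1, x.1} := by
      intro a b h
      refine G.cl_subset (G.cl_mem _) (Set.insert_subset ?_
        ((Set.subset_insert _ _).trans (G.subset_cl _)))
      have ha : a ∈ (G.sub A).cl {b, x} := h ▸ (G.sub A).subset_cl _ (Set.mem_insert _ _)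
      rw [sub_cl, Set.image_pair] at ha
      exact ha
    intro a b h
    exact Set.Subset.antisymm (key _ _ h) (key _ _ h.symm))

end PointGeometry

section Projective

variable (K V : Type*) [DivisionRing K] [AddCommGroup V] [Module K V]

theorem projFlatClosure (A : Set (ℙ K V)) :
    flatClosure {S | ∃ T : Projectivization.Subspace K V, (T : Set (ℙ K V)) = S} A =
      Projectivization.Subspace.span A := by
  apply Set.Subset.antisymm
  · intro x hx
    exact hx _ ⟨⟨_, rfl⟩, Projectivization.Subspace.subset_span A⟩
  · rintro x hx _ ⟨⟨T, rfl⟩, hT⟩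
    exact (Projectivization.Subspace.span_le_subspace_iff.2 hT) hx

/-- The projective space `ℙ(V)` as a geometry, with its projective subspaces as flats. -/
def projGeometry : PointGeometry (ℙ K V) where
  flats := {S | ∃ T : Projectivization.Subspace K V, (T : Set (ℙ K V)) = S}
  empty_mem := ⟨⟨∅, fun _ _ _ _ _ h => h.elim⟩, rfl⟩
  univ_mem := ⟨⟨Set.univ, fun _ _ _ _ _ _ _ => trivial⟩, rfl⟩
  singleton_mem x := by
    refine ⟨⟨{x}, fun v w hv hw hvw h1 h2 => ?_⟩, rfl⟩
    rw [Set.mem_singleton_iff] at h1 h2 ⊢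
    subst h1
    obtain ⟨a, ha⟩ := (Projectivization.mk_eq_mk_iff' K w v hw hv).1 h2
    rw [Projectivization.mk_eq_mk_iff']
    exact ⟨1 + a, by rw [add_smul, one_smul, ha]⟩
  sInter_mem 𝒮 h𝒮 := by
    refine ⟨⟨⋂₀ 𝒮, fun v w hv hw hvw h1 h2 S hS => ?_⟩, rfl⟩
    obtain ⟨T, rfl⟩ := h𝒮 hS
    exact T.mem_add v w hv hw hvw (h1 _ hS) (h2 _ hS)
  exchange := by
    rintro _ ⟨S, rfl⟩ x hx ⟨_, ⟨S', rfl⟩, h1, h2⟩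
    rw [projFlatClosure] at h2
    induction x using Projectivization.ind with
    | h v hv =>
    have hlt : S < S' := h1
    have hlt' : S' < (K ∙ v ⊔ Projectivization.Subspace.submodule S).projectivization := by
      refine lt_of_lt_of_le (b := Projectivization.Subspace.span _) h2 ?_
      rw [Projectivization.Subspace.span_le_subspace_iff]
      refine Set.insert_subset ?_ fun p hp => ?_
      · exact (Submodule.mk_mem_projectivization_iff _ hv).2
          (Submodule.mem_sup_left (Submodule.mem_span_singleton_self v))
      · induction p using Projectivization.ind with
        | h w hw =>
        exact (Submodule.mk_mem_projectivization_iff _ hw).2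
          (Submodule.mem_sup_right ((Projectivization.Subspace.mem_submodule_iff S hw).2 hp))
    have hl := Projectivization.Subspace.submodule.lt_iff_lt.2 hlt
    have hr := Projectivization.Subspace.submodule.lt_iff_lt.2 hlt'
    rw [OrderIso.apply_symm_apply] at hr
    exact (Submodule.wcovBy_span_singleton_sup v _).2 hl hr
  finitary := by
    intro A x hx
    rw [projFlatClosure] at hx
    simp only [projFlatClosure]
    change Projectivization.Subspace.spanCarrier A x at hx
    induction hx with
    | of x hx =>
      exact ⟨{x}, Set.finite_singleton x, by simpa using hx,
        Projectivization.Subspace.subset_span _ rfl⟩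
    | mem_add v w hv hw hvw _ _ ih1 ih2 =>
      obtain ⟨B, hB, hBA, h1⟩ := ih1
      obtain ⟨C, hC, hCA, h2⟩ := ih2
      exact ⟨B ∪ C, hB.union hC, Set.union_subset hBA hCA,
        Projectivization.Subspace.mem_add _ v w hv hw hvw
          (Projectivization.Subspace.monotone_span Set.subset_union_left h1)
          (Projectivization.Subspace.monotone_span Set.subset_union_right h2)⟩

end Projective

section PartialProjective

variable {K V K' V' : Type*} [DivisionRing K] [AddCommGroup V] [Module K V]
  [DivisionRing K'] [AddCommGroup V'] [Module K' V']

/-- The partial map `ℙ(V) ⇢ ℙ(V')`, `⟨v⟩ ↦ ⟨Φ v⟩`, induced by a semilinear map `Φ` and defined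
where `Φ v ≠ 0`. -/
noncomputable def projPartialMap {σ : K →+* K'} (Φ : V →ₛₗ[σ] V') : ℙ K V →. ℙ K' V' :=
  fun p => ⟨Φ p.rep ≠ 0, fun h => Projectivization.mk K' (Φ p.rep) h⟩

theorem mem_projPartialMap_mk {σ : K →+* K'} (Φ : V →ₛₗ[σ] V') (v : V) (hv : v ≠ 0)
    (q : ℙ K' V') :
    q ∈ projPartialMap Φ (Projectivization.mk K v hv) ↔
      ∃ h : Φ v ≠ 0, Projectivization.mk K' (Φ v) h = q := by
  obtain ⟨a, ha⟩ := Projectivization.exists_smul_eq_mk_rep K v hv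
  have h1 : Φ (Projectivization.mk K v hv).rep = σ a • Φ v := by
    rw [← ha, Units.smul_def, map_smulₛₗ]
  have h0 : σ a ≠ 0 := (map_ne_zero σ).2 a.ne_zero
  have hz : Φ (Projectivization.mk K v hv).rep ≠ 0 ↔ Φ v ≠ 0 := by
    rw [h1]; simp [h0]
  have heq : ∀ (h : Φ (Projectivization.mk K v hv).rep ≠ 0) (h' : Φ v ≠ 0),
      Projectivization.mk K' _ h = Projectivization.mk K' _ h' := by
    intro h h'
    rw [Projectivization.mk_eq_mk_iff']
    exact ⟨σ a, h1.symm⟩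
  constructor
  · rintro ⟨h, rfl⟩
    exact ⟨hz.1 h, (heq h (hz.1 h)).symm⟩
  · rintro ⟨h, rfl⟩
    exact ⟨hz.2 h, heq (hz.2 h) h⟩

/-- Partial projective morphisms `ℙ(V) ⇢ ℙ(V')`: the partial maps induced by semilinear maps. -/
def IsPartialProjective (ϕ : ℙ K V →. ℙ K' V') : Prop :=
  ∃ (σ : K →+* K') (Φ : V →ₛₗ[σ] V'), ϕ = projPartialMap Φ

end PartialProjective

/-!
Write `p i` for representatives of the points of `X` and `q i` for representatives of their images.
Project `V'` from the point `φ x₁`. Since `X` and `ℙ` have the same lines through `x₁`, the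
composite of `φ` with this projection is constant along those lines and extends to `ℙ`; the
fundamental theorem of projective geometry, in the version for maps that need not be injective,
shows that it is induced by a semilinear map `V → V' ⧸ ⟨φ x₁⟩`. The same holds for `x₂`. Modulo
the line `L` through `φ x₁` and `φ x₂` the two semilinear maps induce the same partial map, hence
agree up to a scalar, and after rescaling they glue to `Φ : V → V'` because
`V' → V' ⧸ ⟨φ x₁⟩ × V' ⧸ ⟨φ x₂⟩` is injective with image the fibre product over `V' ⧸ L`.

By construction `Φ` induces `φ` at the points that `φ` maps outside `L`. Let `φ x ∈ L`, and choose
points `y`, `z` of `X` such that the plane through the images of `x`, `y`, `z` meets `L` in `φ x`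
only. The fourth point of the plane `x y z` is mapped outside `L`, and its span with `y` and `z`
contains `x`; hence `Φ` maps `x` into `L` and into the plane of the images, that is, to `φ x`.
-/

section LinearAlgebra

variable {K V : Type*} [DivisionRing K] [AddCommGroup V] [Module K V]

theorem span_singleton_eq_of_mem {x y : V} (hy : y ≠ 0) (h : y ∈ K ∙ x) : (K ∙ y) = K ∙ x := by
  obtain ⟨a, rfl⟩ := Submodule.mem_span_singleton.1 h
  exact Submodule.span_singleton_smul_eq (IsUnit.mk0 a (left_ne_zero_of_smul hy)) x

theorem mem_span_singleton_symm {x y : V} (hy : y ≠ 0) (h : y ∈ K ∙ x) : x ∈ K ∙ y :=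
  span_singleton_eq_of_mem hy h ▸ Submodule.mem_span_singleton_self x

theorem eq_zero_iff_of_span_singleton_eq {x y : V} (h : (K ∙ x) = K ∙ y) : x = 0 ↔ y = 0 := by
  rw [← Submodule.span_singleton_eq_bot (R := K), h, Submodule.span_singleton_eq_bot]

theorem mem_iff_of_span_singleton_eq {x y : V} {T : Submodule K V} (h : (K ∙ x) = K ∙ y) :
    x ∈ T ↔ y ∈ T := by
  rw [← Submodule.span_singleton_le_iff_mem, h, Submodule.span_singleton_le_iff_mem]

theorem span_pair_congr {x y x' y' : V} (hx : (K ∙ x) = K ∙ x') (hy : (K ∙ y) = K ∙ y') :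
    Submodule.span K {x, y} = Submodule.span K {x', y'} := by
  rw [Submodule.span_insert, hx, hy, ← Submodule.span_insert]

theorem mem_span_singleton_of_mem_span_pair {a x y w : V} (hy : y ∉ Submodule.span K {a, x})
    (hwx : w ∈ Submodule.span K {a, x}) (hwy : w ∈ Submodule.span K {a, y}) : w ∈ K ∙ a := by
  by_contra hw
  rw [Set.pair_comm] at hwy
  exact hy (Submodule.span_le.2 (Set.insert_subset hwx (by simp [Submodule.mem_span_of_mem]))
    (mem_span_insert_exchange hwy hw))

theorem eq_of_add_mem_span_singleton {u v g x y : V} (hu : u ∉ K ∙ v) (hx : x ∈ K ∙ v)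
    (hy : y ∈ K ∙ v) (hxg : u + x ∈ K ∙ g) (hyg : u + y ∈ K ∙ g) : x = y := by
  by_contra hxy
  have hsub : x - y ∈ K ∙ g := by simpa using Submodule.sub_mem _ hxg hyg
  have hg : g ∈ K ∙ v := Submodule.mem_span_singleton_trans
    (mem_span_singleton_symm (sub_ne_zero.2 hxy) hsub) (Submodule.sub_mem _ hx hy)
  exact hu (by simpa using Submodule.sub_mem _ (Submodule.mem_span_singleton_trans hxg hg) hx)

theorem linearIndependent_triple_iff {x y z : V} :
    LinearIndependent K ![x, y, z] ↔
      ∀ a b c : K, a • x + b • y + c • z = 0 → a = 0 ∧ b = 0 ∧ c = 0 := by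
  simp [Fintype.linearIndependent_iff, Fin.forall_fin_succ_pi, Fin.forall_fin_succ,
    Fin.sum_univ_three]

theorem linearIndependent_triple_of_notMem {x y z : V} (hx : x ≠ 0) (hy : y ∉ K ∙ x)
    (hz : z ∉ Submodule.span K {x, y}) : LinearIndependent K ![x, y, z] := by
  have hxy : LinearIndependent K ![x, y] :=
    (LinearIndependent.pair_iff' hx).2 fun a ha => hy (Submodule.mem_span_singleton.2 ⟨a, ha⟩)
  have hxyz : LinearIndependent K (Fin.snoc ![x, y] z : Fin 3 → V) :=
    linearIndependent_finSnoc.2 ⟨hxy, by simpa [Set.pair_comm y x] using hz⟩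
  convert hxyz using 1
  ext i
  fin_cases i <;> rfl

theorem mem_span_singleton_add_add {u x y w : V} (h : LinearIndependent K ![u, x, y])
    (hx : w ∈ Submodule.span K {u + x, y}) (hy : w ∈ Submodule.span K {u + y, x}) :
    w ∈ K ∙ (u + (x + y)) := by
  obtain ⟨a, b, rfl⟩ := Submodule.mem_span_pair.1 hx
  obtain ⟨c, d, hcd⟩ := Submodule.mem_span_pair.1 hy
  obtain ⟨hac, -, hbc⟩ := linearIndependent_triple_iff.1 h (a - c) (a - d) (b - c) (by
    rw [← sub_eq_zero.2 hcd.symm]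
    simp only [sub_smul, smul_add]
    abel)
  obtain rfl := sub_eq_zero.1 hac
  obtain rfl := sub_eq_zero.1 hbc
  exact Submodule.mem_span_singleton.2 ⟨b, by simp only [smul_add, add_assoc]⟩

theorem mem_span_singleton_add {u x y w : V} (h : LinearIndependent K ![u, x, y])
    (hxy : w ∈ Submodule.span K {x, y}) (hu : w ∈ Submodule.span K {u, u + (x + y)}) :
    w ∈ K ∙ (x + y) := by
  obtain ⟨a, b, rfl⟩ := Submodule.mem_span_pair.1 hxy
  obtain ⟨c, d, hcd⟩ := Submodule.mem_span_pair.1 hu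
  obtain ⟨-, had, hbd⟩ := linearIndependent_triple_iff.1 h (c + d) (d - a) (d - b) (by
    rw [← sub_eq_zero.2 hcd]
    simp only [sub_smul, add_smul, smul_add]
    abel)
  obtain rfl := sub_eq_zero.1 had
  obtain rfl := sub_eq_zero.1 hbd
  exact Submodule.mem_span_singleton.2 ⟨d, smul_add d x y⟩

theorem exists_apply_notMem_span {ι : Type*} [Fintype ι] {f : ι → V} (hf : LinearIndependent K f)
    {s : Finset V} (hs : s.card < Fintype.card ι) : ∃ i, f i ∉ Submodule.span K (s : Set V) := by
  by_contra! h
  have := linearIndependent_le_span' f hf s (Set.range_subset_iff.2 h)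
  simp at this
  omega

theorem linearIndependent_of_span_singleton_eq {ι : Type*} {f g : ι → V}
    (hg : LinearIndependent K g)
    (h : ∀ i, (K ∙ f i) = K ∙ g i) : LinearIndependent K f := by
  choose u hu using fun i => Submodule.span_singleton_eq_span_singleton.1 (h i).symm
  simpa only [← funext hu] using! hg.units_smul u

end LinearAlgebra

section Additive

/-- `f` is additive on the sums which, together with both summands, avoid the subgroup `H`. -/
def AdditiveOff {M N : Type*} [AddCommGroup M] [AddCommGroup N] (H : AddSubgroup M) (f : M → N) :
    Prop :=
  ∀ x y, x ∉ H → y ∉ H → x + y ∉ H → f (x + y) = f x + f y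

namespace AdditiveOff

variable {M N : Type*} [AddCommGroup M] [AddCommGroup N] {H : AddSubgroup M} {f : M → N}

theorem map_add_add_comm (hf : AdditiveOff H f) {h x y : M} (hh : h ∈ H) (hx : x ∉ H)
    (hy : y ∉ H) (hxy : x + y ∉ H) : f (h + x) + f y = f x + f (h + y) := by
  have hadd : ∀ {z}, z ∉ H → h + z ∉ H := fun hz => (H.add_mem_cancel_left hh).not.2 hz
  have hsum : f (h + x + y) = f (h + x) + f y :=
    hf _ _ (hadd hx) hy (by rw [add_assoc]; exact hadd hxy)
  have hsum' : f (x + (h + y)) = f x + f (h + y) :=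
    hf _ _ hx (hadd hy) (by rw [add_left_comm]; exact hadd hxy)
  rw [← hsum, ← hsum', add_left_comm, add_assoc]

theorem sub_eq_sub (hf : AdditiveOff H f) (hH : ∀ x, ∃ z ∉ H, z + x ∉ H ∧ z - x ∉ H)
    {h x y : M} (hh : h ∈ H) (hx : x ∉ H) (hy : y ∉ H) :
    f (h + x) - f x = f (h + y) - f y := by
  have of_add_notMem : ∀ {x y}, x ∉ H → y ∉ H → x + y ∉ H →
      f (h + x) - f x = f (h + y) - f y := fun hx hy hxy =>
    sub_eq_sub_iff_add_eq_add.2 ((hf.map_add_add_comm hh hx hy hxy).trans (add_comm _ _))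
  by_cases hxy : x + y ∈ H
  · obtain ⟨z, hz, hzx, hzx'⟩ := hH x
    have hzy : z + y ∉ H := fun hzy => hzx' (by
      rw [← add_sub_add_right_eq_sub z x y]; exact H.sub_mem hzy hxy)
    exact (of_add_notMem hz hx hzx).symm.trans (of_add_notMem hz hy hzy)
  · exact of_add_notMem hx hy hxy

/-- Off `H` the extension is `f`, and `h ∈ H` is sent to the common value of `f (h + z) - f z`. -/
theorem exists_addMonoidHom (hf : AdditiveOff H f)
    (hH : ∀ x, ∃ z ∉ H, z + x ∉ H ∧ z - x ∉ H) : ∃ A : M →+ N, ∀ x ∉ H, A x = f x := by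
  obtain ⟨z₀, hz₀, -⟩ := hH 0
  obtain ⟨A, map_off, map_on_add⟩ : ∃ A : M → N, (∀ x ∉ H, A x = f x) ∧
      ∀ h ∈ H, ∀ x ∉ H, f (h + x) = A h + f x := by
    classical
    refine ⟨fun x => if x ∈ H then f (x + z₀) - f z₀ else f x, fun x hx => if_neg hx,
      fun h hh x hx => ?_⟩
    beta_reduce
    rw [if_pos hh, ← hf.sub_eq_sub hH hh hx hz₀, sub_add_cancel]
  have hadd : ∀ {h x}, h ∈ H → x ∉ H → h + x ∉ H := fun hh hx =>
    (H.add_mem_cancel_left hh).not.2 hx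
  refine ⟨AddMonoidHom.mk' A fun x y => ?_, map_off⟩
  by_cases hx : x ∈ H <;> by_cases hy : y ∈ H
  · have h := map_on_add _ (H.add_mem hx hy) _ hz₀
    rw [add_assoc, map_on_add x hx _ (hadd hy hz₀), map_on_add y hy _ hz₀, ← add_assoc] at h
    exact (add_right_cancel h).symm
  · rw [map_off _ (hadd hx hy), map_on_add x hx y hy, map_off y hy]
  · rw [add_comm x, map_off _ (hadd hy hx), map_on_add y hy x hx, map_off x hx, add_comm]
  · rw [map_off x hx, map_off y hy]
    by_cases hxy : x + y ∈ H
    · obtain ⟨z, hz, hzy, -⟩ := hH y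
      have hyz : y + z ∉ H := by rwa [add_comm]
      have h := map_on_add _ hxy z hz
      rw [add_assoc, hf x (y + z) hx hyz (by rw [← add_assoc]; exact hadd hxy hz),
        hf y z hy hz hyz, ← add_assoc] at h
      exact (add_right_cancel h).symm
    · rw [map_off _ hxy, hf x y hx hy hxy]

end AdditiveOff

variable {V K' V' : Type*} [AddCommGroup V] [DivisionRing K'] [AddCommGroup V'] [Module K' V']

theorem eq_of_add_smul_eq {c : V → K'} {A : V →+ V'}
    (hc : ∀ u v, c (u + v) • A (u + v) = c u • A u + c v • A v) {u v : V}
    (huv : LinearIndependent K' ![A u, A v]) : c u = c v := by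
  obtain ⟨hu, hv⟩ := LinearIndependent.pair_iff.1 huv (c (u + v) - c u) (c (u + v) - c v) (by
    rw [sub_smul, sub_smul, sub_add_sub_comm, ← smul_add, ← map_add, hc, sub_self])
  exact (sub_eq_zero.1 hu).symm.trans (sub_eq_zero.1 hv)

theorem exists_eq_smul_of_mem_span {A B : V →+ V'} (hB : ∀ v, B v ∈ K' ∙ A v)
    (hA : ∃ p q, LinearIndependent K' ![A p, A q]) : ∃ c : K', ∀ v, B v = c • A v := by
  choose c hc using fun v => Submodule.mem_span_singleton.1 (hB v)
  have hadd : ∀ u v, c (u + v) • A (u + v) = c u • A u + c v • A v := fun u v => by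
    rw [hc, hc, hc, map_add]
  obtain ⟨p, q, hpq⟩ := hA
  have hp0 : A p ≠ 0 := hpq.ne_zero 0
  refine ⟨c p, fun v => ?_⟩
  rw [← hc v]
  by_cases hv0 : A v = 0
  · rw [hv0, smul_zero, smul_zero]
  by_cases hpv : LinearIndependent K' ![A p, A v]
  · rw [eq_of_add_smul_eq hadd hpv]
  · obtain ⟨a, ha⟩ : ∃ a : K', a • A p = A v := by
      simpa only [LinearIndependent.pair_iff' hp0, not_forall, not_not] using hpv
    have hvq : LinearIndependent K' ![A v, A q] := by
      rw [LinearIndependent.pair_iff' hp0] at hpq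
      refine (LinearIndependent.pair_iff' hv0).2 fun b hb => hpq (b * a) ?_
      rw [mul_smul, ha, hb]
    rw [eq_of_add_smul_eq hadd hpq, eq_of_add_smul_eq hadd hvq]

theorem exists_semilinearMap_of_additive {K : Type*} [DivisionRing K] [Module K V] (A : V →+ V')
    (h : ∀ (a : K) v, A (a • v) ∈ K' ∙ A v) (hA : ∃ p q, LinearIndependent K' ![A p, A q]) :
    ∃ (σ : K →+* K') (Φ : V →ₛₗ[σ] V'), ∀ v, Φ v = A v := by
  choose s hs using fun a : K => exists_eq_smul_of_mem_span (A := A)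
    (B := A.comp (DistribSMul.toAddMonoidHom V a)) (h a) hA
  replace hs : ∀ a v, A (a • v) = s a • A v := hs
  obtain ⟨p, q, hpq⟩ := hA
  have smul_inj : ∀ {a b : K'}, a • A p = b • A p → a = b := fun h =>
    smul_left_injective K' (hpq.ne_zero 0) h
  let σ : K →+* K' :=
    { toFun := s
      map_one' := smul_inj (by rw [← hs, one_smul, one_smul])
      map_mul' := fun a b => smul_inj (by rw [← hs, mul_smul, hs, hs, mul_smul])
      map_zero' := smul_inj (by rw [← hs, zero_smul, zero_smul, map_zero])
      map_add' := fun a b => smul_inj (by rw [← hs, add_smul, map_add, hs, hs, add_smul]) }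
  exact ⟨σ, { toFun := A, map_add' := map_add A, map_smul' := hs }, fun v => rfl⟩

end Additive

section Fundamental

variable {K V K' V' ι : Type*} [DivisionRing K] [AddCommGroup V] [Module K V]
  [DivisionRing K'] [AddCommGroup V'] [Module K' V']

variable (K K') in
/-- The assignment `⟨p i⟩ ↦ ⟨q i⟩` is a morphism of geometries, expressed on representing vectors.
Where `q i = 0` it is a partial map, undefined at `⟨p i⟩`. -/
def PullsBackSubmodules (p : ι → V) (q : ι → V') : Prop :=
  ∀ T : Submodule K' V', ∃ W : Submodule K V, ∀ i, p i ∈ W ↔ q i ∈ T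

/-- `x'` represents the point `⟨G x⟩`, scaled so that `G e + x'` represents `⟨G (e + x)⟩`. -/
def IsNormalizedLift (K' : Type*) {V V' : Type*} [AddCommGroup V] [DivisionRing K']
    [AddCommGroup V'] [Module K' V'] (G : V → V') (e x : V) (x' : V') : Prop :=
  (K' ∙ x') = (K' ∙ G x) ∧ G e + x' ∈ K' ∙ G (e + x)

namespace PullsBackSubmodules

theorem mem_span_image {p : ι → V} {q : ι → V'} (h : PullsBackSubmodules K K' p q) {s : Set ι}
    {i : ι} (hi : p i ∈ Submodule.span K (p '' s)) : q i ∈ Submodule.span K' (q '' s) := by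
  obtain ⟨W, hW⟩ := h (Submodule.span K' (q '' s))
  refine (hW i).1 (Submodule.span_le.2 ?_ hi)
  rintro _ ⟨j, hj, rfl⟩
  exact (hW j).2 (Submodule.subset_span ⟨j, hj, rfl⟩)

variable {G : V → V'} (hG : PullsBackSubmodules K K' id G)
include hG

theorem mem_span_pair {u v w : V} (hu : u ∈ Submodule.span K {v, w}) :
    G u ∈ Submodule.span K' {G v, G w} := by
  rw [← Set.image_pair]
  exact hG.mem_span_image (by rwa [Set.image_id])

theorem mem_span_singleton {u v : V} (hu : u ∈ K ∙ v) : G u ∈ K' ∙ G v := by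
  rw [← Set.pair_eq_singleton]
  exact hG.mem_span_pair (by rwa [Set.pair_eq_singleton])

theorem map_add_mem_span_pair (v w : V) : G (v + w) ∈ Submodule.span K' {G v, G w} :=
  hG.mem_span_pair (Submodule.mem_span_pair.2 ⟨1, 1, by simp⟩)

theorem mem_of_map_add_mem {T : Submodule K' V'} {v w : V} (hv : G v ∈ T) (hvw : G (v + w) ∈ T) :
    G w ∈ T := by
  obtain ⟨W, hW⟩ := hG T
  rw [← hW] at hv hvw ⊢
  exact (W.add_mem_iff_right hv).1 hvw

theorem exists_isNormalizedLift {e x : V} (he : G e ≠ 0) (hx : G x ∉ K' ∙ G e) :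
    ∃ x', IsNormalizedLift K' G e x x' := by
  obtain ⟨a, b, hab⟩ := Submodule.mem_span_pair.1 (hG.mem_span_pair (u := e) (v := e + x) (w := x)
    (Submodule.mem_span_pair.2 ⟨1, -1, by simp⟩))
  have hb : b ≠ 0 := by
    rintro rfl
    rw [zero_smul, add_zero] at hab
    exact hx (hG.mem_of_map_add_mem (Submodule.mem_span_singleton_self _)
      (mem_span_singleton_symm he (Submodule.mem_span_singleton.2 ⟨a, hab⟩)))
  refine ⟨-b • G x, Submodule.span_singleton_smul_eq (IsUnit.mk0 _ (neg_ne_zero.2 hb)) _, ?_⟩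
  exact Submodule.mem_span_singleton.2 ⟨a, by rw [neg_smul, ← hab, add_neg_cancel_right]⟩

end PullsBackSubmodules

namespace IsNormalizedLift

variable {G : V → V'} {e x y : V} {x' y' : V'}

theorem mem_span_singleton (h : IsNormalizedLift K' G e x x') : x' ∈ K' ∙ G x :=
  h.1 ▸ Submodule.mem_span_singleton_self x'

theorem unique (hx : G x ∉ K' ∙ G e) (he : G e ≠ 0) (h : IsNormalizedLift K' G e x x')
    (h' : IsNormalizedLift K' G e x y') : x' = y' :=
  eq_of_add_mem_span_singleton (fun hex => hx (mem_span_singleton_symm he hex))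
    h.mem_span_singleton h'.mem_span_singleton h.2 h'.2

theorem span_eq (hx : G x ∉ K' ∙ G e) (he : G e ≠ 0) (h : IsNormalizedLift K' G e x x') :
    (K' ∙ (G e + x')) = K' ∙ G (e + x) := by
  refine span_singleton_eq_of_mem (fun h0 => hx (mem_span_singleton_symm he ?_)) h.2
  rw [eq_neg_of_add_eq_zero_left h0]
  exact Submodule.neg_mem _ h.mem_span_singleton

theorem add (hG : PullsBackSubmodules K K' id G) (he : G e ≠ 0) (hx : G x ∉ K' ∙ G e)
    (hy : G y ∉ Submodule.span K' {G e, G x}) (hx' : IsNormalizedLift K' G e x x')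
    (hy' : IsNormalizedLift K' G e y y') : IsNormalizedLift K' G e (x + y) (x' + y') := by
  have hi := linearIndependent_triple_of_notMem he hx hy
  have hye : G y ∉ K' ∙ G e := fun h => hy (Submodule.span_mono (by simp) h)
  have hyx : G y ∉ K' ∙ G x := fun h => hy (Submodule.span_mono (by simp) h)
  have hexy : G e ∉ Submodule.span K' {G x, G y} := by
    simpa [Set.image_pair] using hi.notMem_span_image (s := {1, 2}) (x := 0) (by decide)
  have hi' : LinearIndependent K' ![G e, x', y'] := linearIndependent_of_span_singleton_eq hi (by
    simpa [Fin.forall_fin_succ] using ⟨hx'.1, hy'.1⟩)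
  have hsum_e : G (e + (x + y)) ∈ K' ∙ (G e + (x' + y')) := by
    refine mem_span_singleton_add_add hi' ?_ ?_
    · rw [span_pair_congr (hx'.span_eq hx he) hy'.1, ← add_assoc]
      exact hG.map_add_mem_span_pair _ _
    · rw [span_pair_congr (hy'.span_eq hye he) hx'.1, add_comm x, ← add_assoc]
      exact hG.map_add_mem_span_pair _ _
  have hsum : G (x + y) ∈ K' ∙ (x' + y') := by
    refine mem_span_singleton_add hi' ?_ (hG.mem_of_map_add_mem (v := e) ?_ ?_)
    · exact span_pair_congr hx'.1 hy'.1 ▸ hG.map_add_mem_span_pair x y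
    · exact Submodule.subset_span (Set.mem_insert _ _)
    · exact Submodule.span_mono (Set.subset_insert _ _) hsum_e
  have hsum0 : G (x + y) ≠ 0 := fun h => hyx
    (hG.mem_of_map_add_mem (Submodule.mem_span_singleton_self _) (h ▸ Submodule.zero_mem _))
  have hsum_e0 : G (e + (x + y)) ≠ 0 := fun h => hexy
    (hG.mem_of_map_add_mem (hG.map_add_mem_span_pair x y)
      (by rw [add_comm, h]; exact Submodule.zero_mem _))
  exact ⟨(span_singleton_eq_of_mem hsum0 hsum).symm, mem_span_singleton_symm hsum_e0 hsum_e⟩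

end IsNormalizedLift

namespace PullsBackSubmodules

variable {G : V → V'} (hG : PullsBackSubmodules K K' id G) {e : V}
include hG

theorem normalizedLift_add_of_notMem (he : G e ≠ 0) {f : V → V'}
    (hf : ∀ x, G x ∉ K' ∙ G e → IsNormalizedLift K' G e x (f x)) {x y : V} (hx : G x ∉ K' ∙ G e)
    (hy : G y ∉ Submodule.span K' {G e, G x}) : f (x + y) = f x + f y := by
  have hle : (K' ∙ G e) ≤ Submodule.span K' {G e, G x} := Submodule.span_mono (by simp)
  have hxy : G (x + y) ∉ K' ∙ G e := fun h => hy
    (hG.mem_of_map_add_mem (Submodule.subset_span (by simp)) (hle h))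
  exact (hf _ hxy).unique hxy he
    (IsNormalizedLift.add hG he hx hy (hf x hx) (hf y fun h => hy (hle h)))

variable (hG3 : ∀ x, ∃ z, G z ∉ Submodule.span K' {G e, G x})
include hG3

theorem normalizedLift_add (he : G e ≠ 0) {f : V → V'}
    (hf : ∀ x, G x ∉ K' ∙ G e → IsNormalizedLift K' G e x (f x)) {x y : V} (hx : G x ∉ K' ∙ G e)
    (hy : G y ∉ K' ∙ G e) (hxy : G (x + y) ∉ K' ∙ G e) : f (x + y) = f x + f y := by
  have hadd {x y} := hG.normalizedLift_add_of_notMem he hf (x := x) (y := y)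
  by_cases hy' : G y ∈ Submodule.span K' {G e, G x}
  · obtain ⟨z, hz⟩ := hG3 x
    have hle : ∀ {w}, G w ∈ Submodule.span K' {G e, G x} →
        G z ∉ Submodule.span K' {G e, G w} := fun hw h => hz
      (Submodule.span_le.2 (Set.insert_subset (Submodule.subset_span (by simp)) (by simpa)) h)
    have hxy' : G (x + y) ∈ Submodule.span K' {G e, G x} :=
      Submodule.span_le.2 (Set.insert_subset (Submodule.subset_span (by simp)) (by simpa))
        (hG.map_add_mem_span_pair x y)
    have hyz : G (y + z) ∉ Submodule.span K' {G e, G x} := fun h => hz (hG.mem_of_map_add_mem hy' h)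
    refine add_right_cancel (b := f z) ?_
    rw [← hadd hxy (hle hxy'), add_assoc, hadd hx hyz, hadd hy (hle hy'), add_assoc]
  · exact hadd hx hy'

theorem exists_notMem_add_sub_notMem (x : V) :
    ∃ z, G z ∉ K' ∙ G e ∧ G (z + x) ∉ K' ∙ G e ∧ G (z - x) ∉ K' ∙ G e := by
  obtain ⟨z, hz⟩ := hG3 x
  have hle : (K' ∙ G e) ≤ Submodule.span K' {G e, G x} := Submodule.span_mono (by simp)
  have hx : G x ∈ Submodule.span K' {G e, G x} := Submodule.subset_span (by simp)
  refine ⟨z, fun h => hz (hle h), fun h => hz ?_, fun h => hz ?_⟩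
  · exact hG.mem_of_map_add_mem hx (add_comm z x ▸ hle h)
  · exact sub_add_cancel z x ▸ Submodule.span_le.2 (Set.insert_subset (hle h) (by simpa))
      (hG.map_add_mem_span_pair (z - x) x)

theorem exists_addMonoidHom (he : G e ≠ 0) :
    ∃ A : V →+ V', ∀ x, G x ∉ K' ∙ G e → (K' ∙ A x) = K' ∙ G x := by
  have hex : ∀ x, ∃ x', G x ∉ K' ∙ G e → IsNormalizedLift K' G e x x' := fun x => by
    by_cases hx : G x ∈ K' ∙ G e
    · exact ⟨0, fun h => absurd hx h⟩
    · obtain ⟨x', hx'⟩ := hG.exists_isNormalizedLift he hx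
      exact ⟨x', fun _ => hx'⟩
  choose f hf using hex
  obtain ⟨W, hW⟩ := hG (K' ∙ G e)
  replace hW : ∀ x, x ∈ W.toAddSubgroup ↔ G x ∈ K' ∙ G e := hW
  have hfW : AdditiveOff W.toAddSubgroup f := fun x y => by
    simp only [hW]
    exact hG.normalizedLift_add hG3 he hf
  obtain ⟨A, hA⟩ := hfW.exists_addMonoidHom (by
    simpa only [hW] using hG.exists_notMem_add_sub_notMem hG3)
  exact ⟨A, fun x hx => by rw [hA x ((hW x).not.2 hx), (hf x hx).1]⟩

theorem mem_span_singleton_of_addMonoidHom {A : V →+ V'}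
    (hA : ∀ x, G x ∉ K' ∙ G e → (K' ∙ A x) = K' ∙ G x) (v : V) : A v ∈ K' ∙ G v := by
  by_cases hv : G v ∈ K' ∙ G e
  · have mem_pair : ∀ {x}, G x ∉ K' ∙ G e → A v ∈ Submodule.span K' {G v, G x} := fun {x} hx => by
      have hvx : G (v + x) ∉ K' ∙ G e := fun h => hx (hG.mem_of_map_add_mem hv h)
      have hGx : G x ∈ Submodule.span K' {G v, G x} := Submodule.subset_span (by simp)
      have hAvx : A (v + x) ∈ Submodule.span K' {G v, G x} :=
        (mem_iff_of_span_singleton_eq (hA _ hvx)).2 (hG.map_add_mem_span_pair v x)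
      rw [← add_sub_cancel_right v x, map_sub]
      simpa using Submodule.sub_mem _ hAvx ((mem_iff_of_span_singleton_eq (hA x hx)).2 hGx)
    obtain ⟨x, hx⟩ := hG3 v
    obtain ⟨y, hy⟩ := hG3 x
    have hle : ∀ z, (K' ∙ G e) ≤ Submodule.span K' {G e, G z} := fun z =>
      Submodule.span_mono (by simp)
    refine mem_span_singleton_of_mem_span_pair (fun h => hy ?_) (mem_pair fun h => hx (hle v h))
      (mem_pair fun h => hy (hle x h))
    exact Submodule.span_le.2 (Set.insert_subset (hle x hv) (by simp [Submodule.mem_span_of_mem])) h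
  · exact (mem_iff_of_span_singleton_eq (hA v hv)).2 (Submodule.mem_span_singleton_self _)

theorem span_singleton_eq_of_addMonoidHom {A : V →+ V'}
    (hA : ∀ x, G x ∉ K' ∙ G e → (K' ∙ A x) = K' ∙ G x) (v : V) : (K' ∙ A v) = K' ∙ G v := by
  by_cases hv : G v ∈ K' ∙ G e
  · by_cases hAv : A v = 0
    · obtain ⟨x, hx, -⟩ := hG.exists_notMem_add_sub_notMem hG3 0
      have hvx : G (v + x) ∉ K' ∙ G e := fun h => hx (hG.mem_of_map_add_mem hv h)
      have hGvx : G (v + x) ∈ K' ∙ G x := by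
        rw [← mem_iff_of_span_singleton_eq (hA _ hvx), map_add, hAv, zero_add, ← hA x hx]
        exact Submodule.mem_span_singleton_self _
      have hGv : G v ∈ K' ∙ G x :=
        hG.mem_of_map_add_mem (Submodule.mem_span_singleton_self _) (add_comm v x ▸ hGvx)
      have hGv0 : G v = 0 := by
        by_contra h
        exact hx (Submodule.mem_span_singleton_trans (mem_span_singleton_symm h hGv) hv)
      rw [hAv, hGv0]
    · exact span_singleton_eq_of_mem hAv (hG.mem_span_singleton_of_addMonoidHom hG3 hA v)
  · exact hA v hv

omit hG3 in
theorem exists_semilinearMap {f : Fin 3 → V} (hf : LinearIndependent K' (G ∘ f)) :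
    ∃ (σ : K →+* K') (Φ : V →ₛₗ[σ] V'), ∀ v, (K' ∙ Φ v) = K' ∙ G v := by
  have hG3 : ∀ x, ∃ z, G z ∉ Submodule.span K' {G (f 0), G x} := fun x => by
    classical
    obtain ⟨i, hi⟩ := exists_apply_notMem_span hf (s := {G (f 0), G x})
      (lt_of_le_of_lt Finset.card_le_two (by simp))
    exact ⟨f i, by simpa using hi⟩
  obtain ⟨A, hA⟩ := hG.exists_addMonoidHom hG3 (hf.ne_zero 0)
  replace hA := hG.span_singleton_eq_of_addMonoidHom hG3 hA
  have hsmul : ∀ (a : K) v, A (a • v) ∈ K' ∙ A v := fun a v => by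
    rw [hA v, mem_iff_of_span_singleton_eq (hA _)]
    exact hG.mem_span_singleton (Submodule.mem_span_singleton.2 ⟨a, rfl⟩)
  have hrank : LinearIndependent K' ![A (f 0), A (f 1)] :=
    linearIndependent_of_span_singleton_eq (hf.comp ![0, 1] (by decide)) (by
      simp [Fin.forall_fin_succ, hA])
  obtain ⟨σ, Φ, hΦ⟩ := exists_semilinearMap_of_additive A hsmul ⟨_, _, hrank⟩
  exact ⟨σ, Φ, fun v => by rw [hΦ, hA]⟩

end PullsBackSubmodules

end Fundamental

section Center

variable {K V K' U ι : Type*} [DivisionRing K] [AddCommGroup V] [Module K V]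
  [DivisionRing K'] [AddCommGroup U] [Module K' U]

variable (K) in
/-- Every line through `⟨p c⟩` contains a further point `⟨p i⟩`: the geometry of the points
`⟨p i⟩` and the whole projective space have the same quotient at `⟨p c⟩`. The vectors `v` on the
line `⟨p c⟩` itself are covered by `i = c`. -/
def IsCenter (p : ι → V) (c : ι) : Prop :=
  ∀ v, ∃ i, Submodule.span K {p c, v} = Submodule.span K {p c, p i}

theorem mem_iff_of_span_pair_eq {W : Submodule K V} {c v w : V}
    (h : Submodule.span K {c, v} = Submodule.span K {c, w}) (hc : c ∈ W) : v ∈ W ↔ w ∈ W := by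
  have mem_iff : ∀ u, u ∈ W ↔ Submodule.span K {c, u} ≤ W := fun u => by
    simp [Submodule.span_le, Set.pair_subset_iff, hc]
  rw [mem_iff, h, mem_iff]

theorem pullsBackSubmodules_comp {σ : K →+* K'} (Φ : V →ₛₗ[σ] U) (p : ι → V) :
    PullsBackSubmodules K K' p (Φ ∘ p) :=
  fun T => ⟨T.comap Φ, fun _ => Iff.rfl⟩

theorem map_mem_span_image {σ : K →+* K'} (Φ : V →ₛₗ[σ] U) {s : Set V} {v : V}
    (hv : v ∈ Submodule.span K s) : Φ v ∈ Submodule.span K' (Φ '' s) :=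
  (pullsBackSubmodules_comp Φ id).mem_span_image (by rwa [Set.image_id])

theorem PullsBackSubmodules.linearIndependent {p : ι → V} {q : ι → U}
    (h : PullsBackSubmodules K K' p q) {κ : Type*} {f : κ → ι}
    (hf : LinearIndependent K' (q ∘ f)) : LinearIndependent K (p ∘ f) := by
  rw [linearIndependent_iff_notMem_span] at hf ⊢
  refine fun i hi => hf i ?_
  rw [Set.image_comp] at hi ⊢
  exact h.mem_span_image hi

namespace IsCenter

variable {p : ι → V} {c : ι} (hc : IsCenter K p c)
include hc

theorem exists_pullsBackSubmodules_id {q : ι → U} (h : PullsBackSubmodules K K' p q)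
    (hqc : q c = 0) :
    ∃ G : V → U, PullsBackSubmodules K K' id G ∧ ∀ i, (K' ∙ G (p i)) = K' ∙ q i := by
  choose r hr using hc
  have hW : ∀ T : Submodule K' U, ∃ W : Submodule K V,
      (∀ i, p i ∈ W ↔ q i ∈ T) ∧ ∀ v, v ∈ W ↔ q (r v) ∈ T := fun T => by
    obtain ⟨W, hW⟩ := h T
    refine ⟨W, hW, fun v => ?_⟩
    rw [mem_iff_of_span_pair_eq (hr v) ((hW c).2 (hqc ▸ T.zero_mem)), hW]
  refine ⟨q ∘ r, fun T => ?_, fun i => le_antisymm ?_ ?_⟩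
  · obtain ⟨W, -, hW⟩ := hW T
    exact ⟨W, hW⟩
  · obtain ⟨W, hW, hW'⟩ := hW (K' ∙ q i)
    rw [Submodule.span_singleton_le_iff_mem, Function.comp_apply, ← hW', hW]
    exact Submodule.mem_span_singleton_self _
  · obtain ⟨W, hW, hW'⟩ := hW (K' ∙ q (r (p i)))
    rw [Submodule.span_singleton_le_iff_mem, Function.comp_apply, ← hW, hW']
    exact Submodule.mem_span_singleton_self _

theorem exists_semilinearMap {q : ι → U} (h : PullsBackSubmodules K K' p q) (hqc : q c = 0)
    {f : Fin 3 → ι} (hf : LinearIndependent K' (q ∘ f)) :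
    ∃ (σ : K →+* K') (Φ : V →ₛₗ[σ] U), ∀ i, (K' ∙ Φ (p i)) = K' ∙ q i := by
  obtain ⟨G, hG, hGq⟩ := hc.exists_pullsBackSubmodules_id h hqc
  have hGf : LinearIndependent K' (G ∘ p ∘ f) :=
    linearIndependent_of_span_singleton_eq hf fun i => hGq (f i)
  obtain ⟨σ, Φ, hΦ⟩ := hG.exists_semilinearMap hGf
  exact ⟨σ, Φ, fun i => (hΦ _).trans (hGq i)⟩

variable {σ τ : K →+* K'} {A : V →ₛₗ[σ] U} {B : V →ₛₗ[τ] U}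

theorem exists_eq_smul (hAc : A (p c) = 0) (hBc : B (p c) = 0)
    (hB : ∀ i, B (p i) ∈ K' ∙ A (p i)) (hA : ∃ u v, LinearIndependent K' ![A u, A v]) :
    ∃ a : K', ∀ v, B v = a • A v := by
  refine exists_eq_smul_of_mem_span (A := A.toAddMonoidHom) (B := B.toAddMonoidHom) (fun v => ?_) hA
  obtain ⟨i, hi⟩ := hc v
  have hAi : A (p i) ∈ K' ∙ A v :=
    (mem_iff_of_span_pair_eq (W := (K' ∙ A v).comap A) hi (by simp [hAc])).1
      (Submodule.mem_span_singleton_self _)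
  exact (mem_iff_of_span_pair_eq (W := (K' ∙ A v).comap B) hi (by simp [hBc])).2
    (Submodule.mem_span_singleton_trans (hB i) hAi)

theorem injective (hA0 : ∀ i, A (p i) ≠ 0) (hA : ∀ i, A (p i) ∈ K' ∙ A (p c) → p i ∈ K ∙ p c) :
    Function.Injective A := by
  rw [injective_iff_map_eq_zero]
  intro v hv
  obtain ⟨i, hi⟩ := hc v
  have hic : A (p i) ∈ K' ∙ A (p c) :=
    (mem_iff_of_span_pair_eq (W := (K' ∙ A (p c)).comap A) hi
      (Submodule.mem_span_singleton_self _)).1 (by simp [hv])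
  obtain ⟨a, rfl⟩ := Submodule.mem_span_singleton.1
    ((mem_iff_of_span_pair_eq hi (Submodule.mem_span_singleton_self _)).2 (hA i hic))
  rw [map_smulₛₗ, smul_eq_zero_iff_left (hA0 c), map_eq_zero] at hv
  rw [hv, zero_smul]

section Embedding

variable (hA : PullsBackSubmodules K' K (A ∘ p) p)
include hA

theorem mem_of_map_mem_span_of_center_mem {s : Set V} {v : V} (hcs : p c ∈ Submodule.span K s)
    (hv : A v ∈ Submodule.span K' (A '' s)) : v ∈ Submodule.span K s := by
  obtain ⟨T, hT⟩ := hA (Submodule.span K s)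
  have mem_iff : ∀ v, v ∈ Submodule.span K s ↔ A v ∈ T := fun v => by
    obtain ⟨i, hi⟩ := hc v
    rw [mem_iff_of_span_pair_eq hi hcs, ← hT]
    exact (mem_iff_of_span_pair_eq (W := T.comap A) hi ((hT c).2 hcs)).symm
  rw [mem_iff]
  refine Submodule.span_le.2 ?_ hv
  rintro _ ⟨w, hw, rfl⟩
  exact (mem_iff w).1 (Submodule.subset_span hw)

theorem center_mem_of_map_mem_span {s : Set V} (hs : A (p c) ∈ Submodule.span K' (A '' s)) :
    p c ∈ Submodule.span K s := by
  suffices finite_case : ∀ t : Set V, t.Finite → A (p c) ∈ Submodule.span K' (A '' t) →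
      p c ∈ Submodule.span K t by
    obtain ⟨_, hts, ht⟩ := Submodule.mem_span_finite_of_mem_span hs
    classical
    obtain ⟨t, ht_sub, rfl⟩ := Finset.subset_set_image_iff.1 hts
    rw [Finset.coe_image] at ht
    exact Submodule.span_mono ht_sub (finite_case t t.finite_toSet ht)
  intro t ht
  induction t, ht using Set.Finite.induction_on with
  | empty =>
    intro h
    obtain ⟨T, hT⟩ := hA (Submodule.span K ∅)
    refine (hT c).1 ?_
    rw [Function.comp_apply, (by simpa using h : A (p c) = 0)]
    exact T.zero_mem
  | @insert w t _ _ ih =>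
    intro h
    by_cases hct : A (p c) ∈ Submodule.span K' (A '' t)
    · exact Submodule.span_mono (Set.subset_insert _ _) (ih hct)
    · have hw : w ∈ Submodule.span K (insert (p c) t) := by
        refine hc.mem_of_map_mem_span_of_center_mem hA (Submodule.subset_span (by simp)) ?_
        rw [Set.image_insert_eq] at h ⊢
        exact mem_span_insert_exchange h hct
      refine mem_span_insert_exchange hw fun hwt => hct ?_
      rwa [Set.image_insert_eq, Submodule.span_insert_eq_span (map_mem_span_image A hwt)] at h

theorem mem_of_map_mem_span {s : Set V} {v : V} (hv : A v ∈ Submodule.span K' (A '' s)) :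
    v ∈ Submodule.span K s := by
  by_cases hcs : A (p c) ∈ Submodule.span K' (A '' s)
  · exact hc.mem_of_map_mem_span_of_center_mem hA (hc.center_mem_of_map_mem_span hA hcs) hv
  · have hvc : v ∈ Submodule.span K (insert (p c) s) :=
      hc.mem_of_map_mem_span_of_center_mem hA (Submodule.subset_span (by simp))
        (Submodule.span_mono (Set.image_mono (Set.subset_insert _ _)) hv)
    by_contra hvs
    refine hcs ?_
    have := map_mem_span_image A (mem_span_insert_exchange hvc hvs)
    rwa [Set.image_insert_eq, Submodule.span_insert_eq_span hv] at this

end Embedding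

end IsCenter

end Center

section TwoCenters

variable {K V K' V' U ι : Type*} [DivisionRing K] [AddCommGroup V] [Module K V]
  [DivisionRing K'] [AddCommGroup V'] [Module K' V'] [AddCommGroup U] [Module K' U]

theorem linearIndependent_mkQ_comp {κ κ' : Type*} {v : κ → V} (hv : LinearIndependent K v)
    {f : κ' → κ} (hf : Function.Injective f) {t : Set κ} (hft : Disjoint (Set.range f) t)
    {P : Submodule K V} (hP : P ≤ Submodule.span K (v '' t)) :
    LinearIndependent K (P.mkQ ∘ v ∘ f) := by
  refine (hv.comp f hf).map ?_
  rw [Submodule.ker_mkQ, Set.range_comp]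
  exact (hv.disjoint_span_image hft).mono_right hP

theorem PullsBackSubmodules.linearMap_comp {p : ι → V} {q : ι → V'}
    (h : PullsBackSubmodules K K' p q) (π : V' →ₗ[K'] U) : PullsBackSubmodules K K' p (π ∘ q) :=
  fun T => h (T.comap π)

theorem span_singleton_map_eq {x y : V'} (h : (K' ∙ x) = K' ∙ y) (π : V' →ₗ[K'] U) :
    (K' ∙ π x) = K' ∙ π y := by
  rw [← Set.image_singleton, ← Submodule.map_span, h, Submodule.map_span, Set.image_singleton]

theorem mem_span_singleton_of_mem_span_triple {σ : K →+* K'} {f : V →ₛₗ[σ] U} {x y z w : V}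
    (hx : f x = 0) (hyz : LinearIndependent K' ![f y, f z])
    (hw : w ∈ Submodule.span K {x, y, z}) (hfw : f w = 0) : w ∈ K ∙ x := by
  obtain ⟨a, b, c, rfl⟩ := Submodule.mem_span_triple.1 hw
  obtain ⟨hb, hc⟩ := LinearIndependent.pair_iff.1 hyz (σ b) (σ c) (by simpa [hx] using hfw)
  rw [map_eq_zero] at hb hc
  exact Submodule.mem_span_singleton.2 ⟨a, by simp [hb, hc]⟩

theorem span_singleton_eq_of_mkQ {P₁ P₂ : Submodule K V} (hP : Disjoint P₁ P₂) {x y : V}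
    (hx : x ∉ P₁ ⊔ P₂) (h₁ : (K ∙ P₁.mkQ y) = K ∙ P₁.mkQ x)
    (h₂ : P₂.mkQ y ∈ K ∙ P₂.mkQ x) : (K ∙ y) = K ∙ x := by
  obtain ⟨a, ha⟩ := Submodule.mem_span_singleton.1 (h₁ ▸ Submodule.mem_span_singleton_self _)
  obtain ⟨b, hb⟩ := Submodule.mem_span_singleton.1 h₂
  rw [← map_smul, Submodule.mkQ_apply, Submodule.mkQ_apply, Submodule.Quotient.eq] at ha hb
  obtain rfl : a = b := by
    by_contra hab
    refine hx ((Submodule.smul_mem_iff _ (sub_ne_zero.2 hab)).1 ?_)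
    rw [sub_smul, ← sub_sub_sub_cancel_right _ _ y]
    exact Submodule.sub_mem _ (Submodule.mem_sup_left ha) (Submodule.mem_sup_right hb)
  have hy : a • x = y := sub_eq_zero.1 (Submodule.disjoint_def.1 hP _ ha hb)
  refine span_singleton_eq_of_mem ?_ (Submodule.mem_span_singleton.2 ⟨a, hy⟩)
  rintro rfl
  have hx₁ : P₁.mkQ x = 0 := (eq_zero_iff_of_span_singleton_eq h₁).1 (map_zero _)
  exact hx (Submodule.mem_sup_left (by simpa using hx₁))

theorem mem_of_mkQ_mem_span_singleton {P L : Submodule K V} (hPL : P ≤ L) {x y : V}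
    (hxy : P.mkQ x ∈ K ∙ P.mkQ y) (hy : y ∈ L) : x ∈ L := by
  obtain ⟨a, ha⟩ := Submodule.mem_span_singleton.1 hxy
  have hsub : a • y - x ∈ L := hPL ((Submodule.Quotient.eq P).1 ha)
  exact (L.sub_mem_iff_right (L.smul_mem a hy)).1 hsub

theorem exists_mkQ_eq_mkQ_eq {P₁ P₂ : Submodule K V} {x₁ : V ⧸ P₁} {x₂ : V ⧸ P₂}
    (h : Submodule.factor (le_sup_left : P₁ ≤ P₁ ⊔ P₂) x₁ =
      Submodule.factor (le_sup_right : P₂ ≤ P₁ ⊔ P₂) x₂) :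
    ∃ w, P₁.mkQ w = x₁ ∧ P₂.mkQ w = x₂ := by
  obtain ⟨u, rfl⟩ := P₁.mkQ_surjective x₁
  obtain ⟨v, rfl⟩ := P₂.mkQ_surjective x₂
  obtain ⟨a, ha, b, hb, hab⟩ := Submodule.mem_sup.1 ((Submodule.Quotient.eq _).1 h)
  have hw : u - a = v + b := by
    rw [sub_eq_iff_eq_add, add_assoc, add_comm b, hab]
    exact (add_sub_cancel v u).symm
  refine ⟨u - a, ?_, ?_⟩
  · simpa using ha
  · rw [hw]
    simpa using hb

theorem exists_semilinearMap_of_disjoint {σ : K →+* K'} {P₁ P₂ : Submodule K' V'}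
    (hP : Disjoint P₁ P₂) {A : V →ₛₗ[σ] V' ⧸ P₁} {B : V →ₛₗ[σ] V' ⧸ P₂}
    (h : ∀ v, ∃ w, P₁.mkQ w = A v ∧ P₂.mkQ w = B v) :
    ∃ Φ : V →ₛₗ[σ] V', ∀ v, P₁.mkQ (Φ v) = A v ∧ P₂.mkQ (Φ v) = B v := by
  have ext : ∀ {u w : V'}, P₁.mkQ u = P₁.mkQ w → P₂.mkQ u = P₂.mkQ w → u = w := fun h₁ h₂ =>
    sub_eq_zero.1 (Submodule.disjoint_def.1 hP _ ((Submodule.Quotient.eq _).1 h₁)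
      ((Submodule.Quotient.eq _).1 h₂))
  choose Φ hA hB using h
  exact ⟨{ toFun := Φ
           map_add' u v := ext (by simp only [map_add, hA]) (by simp only [map_add, hB])
           map_smul' a v := ext (by simp only [map_smul, map_smulₛₗ, hA])
             (by simp only [map_smul, map_smulₛₗ, hB]) }, fun v => ⟨hA v, hB v⟩⟩

theorem semiconjBy_of_eq_smul {σ τ : K →+* K'} {A : V →ₛₗ[σ] U} {B : V →ₛₗ[τ] U} {a : K'}
    (h : ∀ v, B v = a • A v) {v : V} (hv : A v ≠ 0) (b : K) : SemiconjBy a (σ b) (τ b) := by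
  refine smul_left_injective K' hv ?_
  simp only [mul_smul]
  rw [← map_smulₛₗ, ← h, ← h, map_smulₛₗ]

theorem exists_smul_eq_of_semiconjBy {σ τ : K →+* K'} {a : K'} (ha : a ≠ 0)
    (h : ∀ b, SemiconjBy a (σ b) (τ b)) (B : V →ₛₗ[τ] U) :
    ∃ C : V →ₛₗ[σ] U, ∀ v, a • C v = B v := by
  refine ⟨{ toFun := fun v => a⁻¹ • B v
            map_add' := fun u v => by rw [map_add, smul_add]
            map_smul' := fun b v => ?_ }, fun v => smul_inv_smul₀ ha _⟩
  rw [map_smulₛₗ, smul_smul, smul_smul, (h b).inv_symm_left₀.eq]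

namespace IsCenter

variable {p : ι → V} {c : ι} (hc : IsCenter K p c)
include hc

theorem exists_semilinearMap_mkQ {q : ι → V'} {P₁ P₂ : Submodule K' V'} (hP : Disjoint P₁ P₂)
    (hqc : q c ∈ P₁ ⊔ P₂) {i j : ι}
    (hij : LinearIndependent K' ![(P₁ ⊔ P₂).mkQ (q i), (P₁ ⊔ P₂).mkQ (q j)])
    {σ τ : K →+* K'} {A : V →ₛₗ[σ] V' ⧸ P₁} {B : V →ₛₗ[τ] V' ⧸ P₂}
    (hA : ∀ i, (K' ∙ A (p i)) = K' ∙ P₁.mkQ (q i))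
    (hB : ∀ i, (K' ∙ B (p i)) = K' ∙ P₂.mkQ (q i)) :
    ∃ Φ : V →ₛₗ[σ] V', ∀ i, (K' ∙ P₁.mkQ (Φ (p i))) = (K' ∙ P₁.mkQ (q i)) ∧
      (K' ∙ P₂.mkQ (Φ (p i))) = K' ∙ P₂.mkQ (q i) := by
  let π₁ := Submodule.factor (le_sup_left : P₁ ≤ P₁ ⊔ P₂)
  let π₂ := Submodule.factor (le_sup_right : P₂ ≤ P₁ ⊔ P₂)
  have hA' : ∀ i, (K' ∙ π₁ (A (p i))) = K' ∙ (P₁ ⊔ P₂).mkQ (q i) := fun i =>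
    span_singleton_map_eq (hA i) π₁
  have hB' : ∀ i, (K' ∙ π₂ (B (p i))) = K' ∙ (P₁ ⊔ P₂).mkQ (q i) := fun i =>
    span_singleton_map_eq (hB i) π₂
  have hqc' : (P₁ ⊔ P₂).mkQ (q c) = 0 := by simpa using hqc
  have hAij : LinearIndependent K' ![π₁ (A (p i)), π₁ (A (p j))] :=
    linearIndependent_of_span_singleton_eq hij (by simp [Fin.forall_fin_two, hA'])
  have hBi : π₂ (B (p i)) ≠ 0 :=
    (eq_zero_iff_of_span_singleton_eq (hB' i)).not.2 (hij.ne_zero 0)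
  obtain ⟨a, ha⟩ := hc.exists_eq_smul (A := π₁.comp A) (B := π₂.comp B)
    ((eq_zero_iff_of_span_singleton_eq (hA' c)).2 hqc')
    ((eq_zero_iff_of_span_singleton_eq (hB' c)).2 hqc')
    (fun i => (Submodule.span_singleton_le_iff_mem _ _).1 ((hB' i).trans (hA' i).symm).le)
    ⟨_, _, hAij⟩
  have ha0 : a ≠ 0 := by
    rintro rfl
    exact hBi (by simpa using ha (p i))
  obtain ⟨C, hC⟩ := exists_smul_eq_of_semiconjBy ha0
    (semiconjBy_of_eq_smul ha (hAij.ne_zero 0)) B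
  obtain ⟨Φ, hΦ⟩ := exists_semilinearMap_of_disjoint hP (A := A) (B := C) fun v =>
    exists_mkQ_eq_mkQ_eq (smul_right_injective _ ha0 (by
      simpa [← hC] using (ha v).symm))
  refine ⟨Φ, fun i => ⟨by rw [(hΦ _).1, hA], ?_⟩⟩
  rw [(hΦ _).2, ← hB, ← hC, Submodule.span_singleton_smul_eq (IsUnit.mk0 a ha0)]

end IsCenter

variable {p : ι → V} {q : ι → V'} {y : Fin 4 → ι}

theorem disjoint_span_singleton_of_linearIndependent {κ : Type*} {v : κ → V}
    (hv : LinearIndependent K v) {i j : κ} (hij : i ≠ j) : Disjoint (K ∙ v i) (K ∙ v j) := by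
  simpa using hv.disjoint_span_image (Set.disjoint_singleton.2 hij)

theorem linearIndependent_mkQ_pair {v : Fin 4 → V} (hv : LinearIndependent K v) :
    LinearIndependent K
      ![((K ∙ v 0) ⊔ K ∙ v 1).mkQ (v 2), ((K ∙ v 0) ⊔ K ∙ v 1).mkQ (v 3)] := by
  have h := linearIndependent_mkQ_comp hv (f := ![2, 3]) (t := {0, 1})
    (by decide) (by simp) (P := (K ∙ v 0) ⊔ K ∙ v 1)
    (by rw [← Submodule.span_insert, Set.image_pair])
  convert h using 1
  ext i
  fin_cases i <;> rfl

theorem exists_semilinearMap_mkQ_span_singleton (hy₀ : IsCenter K p (y 0))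
    (hy₁ : IsCenter K p (y 1)) (h : PullsBackSubmodules K K' p q)
    (hqy : LinearIndependent K' (q ∘ y)) :
    ∃ (σ : K →+* K') (Φ : V →ₛₗ[σ] V'), ∀ i,
      (K' ∙ (K' ∙ q (y 0)).mkQ (Φ (p i))) = (K' ∙ (K' ∙ q (y 0)).mkQ (q i)) ∧
      (K' ∙ (K' ∙ q (y 1)).mkQ (Φ (p i))) = K' ∙ (K' ∙ q (y 1)).mkQ (q i) := by
  have exists_mod : ∀ {c : Fin 4}, IsCenter K p (y c) → ∃ (σ : K →+* K')
      (A : V →ₛₗ[σ] V' ⧸ (K' ∙ q (y c))), ∀ i, (K' ∙ A (p i)) = K' ∙ (K' ∙ q (y c)).mkQ (q i) :=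
    fun {c} hc => by
      have hli : LinearIndependent K' ((K' ∙ q (y c)).mkQ ∘ q ∘ y ∘ c.succAbove) :=
        linearIndependent_mkQ_comp hqy Fin.succAbove_right_injective (t := {c}) (by simp) (by simp)
      exact hc.exists_semilinearMap (h.linearMap_comp _) (by simp) hli
  obtain ⟨σ, A, hA⟩ := exists_mod hy₀
  obtain ⟨τ, B, hB⟩ := exists_mod hy₁
  exact ⟨σ, hy₀.exists_semilinearMap_mkQ
    (disjoint_span_singleton_of_linearIndependent hqy (by decide : (0 : Fin 4) ≠ 1))
    (Submodule.mem_sup_left (Submodule.mem_span_singleton_self _))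
    (linearIndependent_mkQ_pair hqy) hA hB⟩

variable (K) in
/-- Every plane through `⟨p x⟩` spanned by points `⟨p i⟩` contains a further such point off the line
joining the other two: the part of having enough points that the extension argument needs. -/
def HasPlanePoints (p : ι → V) : Prop :=
  ∀ x y z, LinearIndependent K ![p x, p y, p z] →
    ∃ i, p i ∈ Submodule.span K {p x, p y, p z} ∧ p i ∉ K ∙ p x ∧ p i ∉ Submodule.span K {p y, p z}

theorem ne_zero_of_mkQ {P₁ P₂ : Submodule K' V'} (hP : Disjoint P₁ P₂)
    {x y : V'} (hy : y ≠ 0) (h₁ : (K' ∙ P₁.mkQ x) = K' ∙ P₁.mkQ y)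
    (h₂ : (K' ∙ P₂.mkQ x) = K' ∙ P₂.mkQ y) : x ≠ 0 := by
  rintro rfl
  have hy₁ := (eq_zero_iff_of_span_singleton_eq h₁).1 (map_zero _)
  have hy₂ := (eq_zero_iff_of_span_singleton_eq h₂).1 (map_zero _)
  exact hy (Submodule.disjoint_def.1 hP _ (by simpa using hy₁) (by simpa using hy₂))

theorem linearIndependent_triple_of_mkQ {L : Submodule K V} {x y z : V} (hx : x ≠ 0) (hxL : x ∈ L)
    (hyz : LinearIndependent K ![L.mkQ y, L.mkQ z]) : LinearIndependent K ![x, y, z] := by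
  refine linearIndependent_triple_iff.2 fun a b c habc => ?_
  have hxL' : L.mkQ x = 0 := by simpa using hxL
  obtain ⟨rfl, rfl⟩ := LinearIndependent.pair_iff.1 hyz b c (by
    simpa only [map_add, map_smul, hxL', smul_zero, zero_add, map_zero] using congr(L.mkQ $habc))
  simpa [hx] using habc

/-- The point `⟨p i⟩` lies in the plane spanned by two points off `L` and a fourth point of the
plane, all of whose images are known. -/
theorem HasPlanePoints.span_singleton_map_eq_of_mem {σ : K →+* K'} {Φ : V →ₛₗ[σ] V'}
    (hp : HasPlanePoints K p) (h : PullsBackSubmodules K K' p q) {L : Submodule K' V'}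
    (hΦ : ∀ i, q i ∉ L → (K' ∙ Φ (p i)) = K' ∙ q i) (hΦL : ∀ i, q i ∈ L → Φ (p i) ∈ L)
    {j k : ι} (hjk : LinearIndependent K' ![L.mkQ (q j), L.mkQ (q k)])
    {i : ι} (hiL : q i ∈ L) (hqi : q i ≠ 0) (hΦi : Φ (p i) ≠ 0) :
    (K' ∙ Φ (p i)) = K' ∙ q i := by
  have hjL : q j ∉ L := by simpa using hjk.ne_zero 0
  have hkL : q k ∉ L := by simpa using hjk.ne_zero 1
  have hijk : LinearIndependent K ![p i, p j, p k] := by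
    have hq : LinearIndependent K' (q ∘ ![i, j, k]) := by
      rw [← FinVec.map_eq]
      exact linearIndependent_triple_of_mkQ hqi hiL hjk
    have hp := h.linearIndependent hq
    rwa [← FinVec.map_eq] at hp
  obtain ⟨l, hl, hli, hljk⟩ := hp i j k hijk
  have hlL : q l ∉ L := fun hlL => hli (by
    refine mem_span_singleton_of_mem_span_triple (f := L.mkQ.comp Φ) ?_ ?_ hl ?_
    · simpa using hΦL i hiL
    · refine linearIndependent_of_span_singleton_eq hjk ?_
      exact Fin.forall_fin_two.2
        ⟨span_singleton_map_eq (hΦ j hjL) L.mkQ, span_singleton_map_eq (hΦ k hkL) L.mkQ⟩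
    · simpa using hΦL l hlL)
  have hql : q l ∈ Submodule.span K' {q i, q j, q k} := by
    simpa only [Set.image_insert_eq, Set.image_singleton] using
      h.mem_span_image (s := {i, j, k}) (by simpa only [Set.image_insert_eq, Set.image_singleton])
  have hΦ_mem : Φ (p i) ∈ Submodule.span K' {q i, q j, q k} := by
    refine Submodule.span_le.2 ?_ (map_mem_span_image Φ (mem_span_insert_exchange hl hljk))
    rintro _ ⟨_, rfl | rfl | rfl, rfl⟩
    · exact (mem_iff_of_span_singleton_eq (hΦ _ hlL)).2 hql
    · exact (mem_iff_of_span_singleton_eq (hΦ _ hjL)).2 (Submodule.subset_span (by simp))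
    · exact (mem_iff_of_span_singleton_eq (hΦ _ hkL)).2 (Submodule.subset_span (by simp))
  exact span_singleton_eq_of_mem hΦi (mem_span_singleton_of_mem_span_triple (f := L.mkQ)
    (by simpa using hiL) hjk hΦ_mem (by simpa using hΦL i hiL))

theorem HasPlanePoints.span_singleton_map_eq_of_mkQ {σ : K →+* K'} {Φ : V →ₛₗ[σ] V'}
    (hp : HasPlanePoints K p) (h : PullsBackSubmodules K K' p q) (hq : ∀ i, q i ≠ 0)
    {P₁ P₂ : Submodule K' V'} (hP : Disjoint P₁ P₂) {j k : ι}
    (hjk : LinearIndependent K' ![(P₁ ⊔ P₂).mkQ (q j), (P₁ ⊔ P₂).mkQ (q k)])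
    (hΦ : ∀ i, (K' ∙ P₁.mkQ (Φ (p i))) = (K' ∙ P₁.mkQ (q i)) ∧
      (K' ∙ P₂.mkQ (Φ (p i))) = K' ∙ P₂.mkQ (q i)) (i : ι) :
    (K' ∙ Φ (p i)) = K' ∙ q i := by
  have hΦ_of_notMem : ∀ i, q i ∉ P₁ ⊔ P₂ → (K' ∙ Φ (p i)) = K' ∙ q i := fun i hi =>
    span_singleton_eq_of_mkQ hP hi (hΦ i).1
      ((Submodule.span_singleton_le_iff_mem _ _).1 (hΦ i).2.le)
  have hΦ_of_mem : ∀ i, q i ∈ P₁ ⊔ P₂ → Φ (p i) ∈ P₁ ⊔ P₂ := fun i hi =>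
    mem_of_mkQ_mem_span_singleton le_sup_left
      ((Submodule.span_singleton_le_iff_mem _ _).1 (hΦ i).1.le) hi
  by_cases hi : q i ∈ P₁ ⊔ P₂
  · exact hp.span_singleton_map_eq_of_mem h hΦ_of_notMem hΦ_of_mem hjk hi (hq i)
      (ne_zero_of_mkQ hP (hq i) (hΦ i).1 (hΦ i).2)
  · exact hΦ_of_notMem i hi

theorem exists_semilinearMap_of_isCenter (hy₀ : IsCenter K p (y 0)) (hy₁ : IsCenter K p (y 1))
    (hp : HasPlanePoints K p) (hq : ∀ i, q i ≠ 0) (h : PullsBackSubmodules K K' p q)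
    (hqy : LinearIndependent K' (q ∘ y)) :
    ∃ (σ : K →+* K') (Φ : V →ₛₗ[σ] V'), ∀ i, (K' ∙ Φ (p i)) = K' ∙ q i := by
  obtain ⟨σ, Φ, hΦ⟩ := exists_semilinearMap_mkQ_span_singleton hy₀ hy₁ h hqy
  exact ⟨σ, Φ, hp.span_singleton_map_eq_of_mkQ h hq
    (disjoint_span_singleton_of_linearIndependent hqy (by decide : (0 : Fin 4) ≠ 1))
    (linearIndependent_mkQ_pair hqy) hΦ⟩

theorem IsCenter.exists_sub_smul_mem {c : ι} (hc : IsCenter K p c) {σ τ : K →+* K'}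
    {Φ : V →ₛₗ[σ] V'} {Ψ : V →ₛₗ[τ] V'} (hΨ : ∀ i, Ψ (p i) ∈ K' ∙ Φ (p i))
    {P : Submodule K' V'} (hcP : Φ (p c) ∈ P) {f : Fin 2 → ι}
    (hf : LinearIndependent K' (P.mkQ ∘ Φ ∘ p ∘ f)) : ∃ a : K', ∀ v, Ψ v - a • Φ v ∈ P := by
  have hΨ' : ∀ i, P.mkQ (Ψ (p i)) ∈ K' ∙ P.mkQ (Φ (p i)) := fun i => by
    obtain ⟨b, hb⟩ := Submodule.mem_span_singleton.1 (hΨ i)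
    exact Submodule.mem_span_singleton.2 ⟨b, by rw [← hb, map_smul]⟩
  have hcP' : Ψ (p c) ∈ P := (Submodule.span_singleton_le_iff_mem _ _).2 hcP (hΨ c)
  rw [← FinVec.etaExpand_eq (P.mkQ ∘ Φ ∘ p ∘ f)] at hf
  obtain ⟨a, ha⟩ := hc.exists_eq_smul (A := P.mkQ.comp Φ) (B := P.mkQ.comp Ψ)
    (by simpa using hcP) (by simpa using hcP') hΨ' ⟨_, _, hf⟩
  exact ⟨a, fun v => (Submodule.Quotient.eq P).1 (ha v)⟩

theorem exists_eq_smul_of_isCenter {y : Fin 3 → ι} {σ τ : K →+* K'} {Φ : V →ₛₗ[σ] V'}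
    {Ψ : V →ₛₗ[τ] V'} (hy₀ : IsCenter K p (y 0)) (hy₁ : IsCenter K p (y 1))
    (hΦ : LinearIndependent K' (Φ ∘ p ∘ y)) (hΨ : ∀ i, Ψ (p i) ∈ K' ∙ Φ (p i)) :
    ∃ a : K', ∀ v, Ψ v = a • Φ v := by
  have exists_mod : ∀ {c : Fin 3}, IsCenter K p (y c) →
      ∃ a : K', ∀ v, Ψ v - a • Φ v ∈ K' ∙ Φ (p (y c)) := fun {c} hc =>
    hc.exists_sub_smul_mem (f := y ∘ c.succAbove) hΨ (Submodule.mem_span_singleton_self _)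
      (linearIndependent_mkQ_comp hΦ Fin.succAbove_right_injective (t := {c}) (by simp) (by simp))
  obtain ⟨a, ha⟩ := exists_mod hy₀
  obtain ⟨b, hb⟩ := exists_mod hy₁
  obtain rfl : a = b := by
    by_contra hab
    refine hΦ.notMem_span_image (s := {0, 1}) (x := 2) (by simp)
      ((Submodule.smul_mem_iff _ (sub_ne_zero.2 hab)).1 ?_)
    rw [Set.image_pair, Submodule.span_insert, sub_smul,
      ← sub_sub_sub_cancel_left _ _ (Ψ (p (y 2)))]
    exact Submodule.sub_mem _ (Submodule.mem_sup_right (hb _)) (Submodule.mem_sup_left (ha _))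
  exact ⟨a, fun v => sub_eq_zero.1 (Submodule.disjoint_def.1
    (disjoint_span_singleton_of_linearIndependent hΦ (by decide : (0 : Fin 3) ≠ 1)) _
    (ha v) (hb v))⟩

end TwoCenters

section Geometry

namespace PointGeometry

variable {X X' : Type*} {G : PointGeometry X} {G' : PointGeometry X'}

theorem Indep.sub {A : Set X} {B : Set A} (h : G.Indep (Subtype.val '' B)) :
    (G.sub A).Indep B := by
  intro b hb hmem
  rw [sub_cl] at hmem
  refine h b.1 ⟨b, hb, rfl⟩ ?_
  rwa [Set.mem_preimage, Set.image_sdiff Subtype.val_injective, Set.image_singleton] at hmem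

theorem IsEmbedding.injective {f : X → X'} (hf : G.IsEmbedding G' f) : Function.Injective f := by
  obtain ⟨-, -, g, hg, -⟩ := hf
  exact Set.rangeFactorization_injective.1 hg.injective

theorem isEmbedding_iff {f : X → X'} :
    G.IsEmbedding G' f ↔ G.IsMorphism G' f ∧ ∀ S ∈ G.flats, ∃ S' ∈ G'.flats, f ⁻¹' S' = S := by
  refine and_congr_right fun hf => ⟨?_, fun h => ⟨?_, ?_⟩⟩
  · rintro ⟨-, g, hleft, -, hg⟩ S hS
    obtain ⟨S', hS', h⟩ := hg S hS
    refine ⟨S', hS', Set.ext fun x => ?_⟩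
    have hx := Set.ext_iff.1 h (Set.rangeFactorization f x)
    rw [Set.mem_preimage, hleft x] at hx
    exact hx.symm
  · rintro _ ⟨S, hS, rfl⟩
    exact hf S hS
  · have hinj : Function.Injective f := fun x y hxy => by
      obtain ⟨S', -, hS'⟩ := h {x} (G.singleton_mem x)
      have hy : y ∈ f ⁻¹' S' := by
        rw [Set.mem_preimage, ← hxy, ← Set.mem_preimage, hS']
        exact Set.mem_singleton x
      rw [hS'] at hy
      exact (Set.mem_singleton_iff.1 hy).symm
    refine ⟨(Equiv.ofInjective f hinj).symm, (Equiv.ofInjective f hinj).left_inv,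
      (Equiv.ofInjective f hinj).right_inv, fun S hS => ?_⟩
    obtain ⟨S', hS', rfl⟩ := h S hS
    refine ⟨S', hS', Set.ext fun y => ?_⟩
    rw [Set.mem_preimage, Set.mem_preimage, Equiv.apply_ofInjective_symm hinj]
    rfl

theorem EnoughPoints.exists_mem_ne_notMem (hG : G.EnoughPoints) {P L : Set X}
    (hP : G.IsPlane P) (hL : G.IsLine L) (x : X) : ∃ q ∈ P, q ≠ x ∧ q ∉ L := by
  obtain ⟨Q, hQP, hQ_card, hQ⟩ := hG.2 P hP
  by_contra! mem_line
  have three_le : 3 ≤ (Q \ {x}).encard := by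
    have encard_le := Set.encard_le_encard_sdiff_add_encard Q {x}
    rw [hQ_card, Set.encard_singleton] at encard_le
    exact (ENat.add_le_add_iff_right (k := 1) (by simp)).1 (le_trans (by norm_num) encard_le)
  obtain ⟨T, hT, hT_card⟩ := Set.exists_subset_encard_eq three_le
  exact hQ T (hT.trans Set.sdiff_subset) hT_card
    ⟨L, hL, fun t ht => mem_line t (hQP (hT ht).1) (hT ht).2⟩

end PointGeometry

variable {K V : Type*} [DivisionRing K] [AddCommGroup V] [Module K V]

theorem mem_flats_projGeometry_iff {S : Set (ℙ K V)} :
    S ∈ (projGeometry K V).flats ↔ ∃ W : Submodule K V, ∀ p, p ∈ S ↔ p.rep ∈ W := by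
  constructor
  · rintro ⟨T, rfl⟩
    refine ⟨Projectivization.Subspace.submodule T, fun p => ?_⟩
    rw [Projectivization.Subspace.mem_submodule_iff T p.rep_nonzero, p.mk_rep]
    rfl
  · rintro ⟨W, hW⟩
    refine ⟨W.projectivization, Set.ext fun p => ?_⟩
    rw [hW, SetLike.mem_coe, ← Submodule.mk_mem_projectivization_iff W p.rep_nonzero, p.mk_rep]

theorem setOf_rep_mem_mem_flats (W : Submodule K V) :
    {p : ℙ K V | p.rep ∈ W} ∈ (projGeometry K V).flats :=
  mem_flats_projGeometry_iff.2 ⟨W, fun _ => Iff.rfl⟩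

theorem mem_cl_projGeometry_iff {A : Set (ℙ K V)} {p : ℙ K V} :
    p ∈ (projGeometry K V).cl A ↔ p.rep ∈ Submodule.span K (Projectivization.rep '' A) := by
  constructor
  · exact fun h => (projGeometry K V).cl_subset
      (setOf_rep_mem_mem_flats (Submodule.span K (Projectivization.rep '' A)))
      (fun q hq => Submodule.subset_span (Set.mem_image_of_mem _ hq)) h
  · intro h
    obtain ⟨W, hW⟩ := mem_flats_projGeometry_iff.1 ((projGeometry K V).cl_mem A)
    rw [hW]
    refine Submodule.span_le.2 ?_ h
    rintro _ ⟨q, hq, rfl⟩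
    exact (hW q).1 ((projGeometry K V).subset_cl A hq)

theorem span_rep_image_eq_of_cl_eq {A B : Set (ℙ K V)}
    (h : (projGeometry K V).cl A = (projGeometry K V).cl B) :
    Submodule.span K (Projectivization.rep '' A) =
      Submodule.span K (Projectivization.rep '' B) := by
  have span_le : ∀ {A B : Set (ℙ K V)}, (projGeometry K V).cl A = (projGeometry K V).cl B →
      Submodule.span K (Projectivization.rep '' A) ≤
        Submodule.span K (Projectivization.rep '' B) := fun {A B} h => by
    rw [Submodule.span_le]
    rintro _ ⟨p, hp, rfl⟩
    exact mem_cl_projGeometry_iff.1 (h ▸ (projGeometry K V).subset_cl A hp)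
  exact le_antisymm (span_le h) (span_le h.symm)

theorem eq_of_rep_mem_span_singleton {p q : ℙ K V} (h : p.rep ∈ K ∙ q.rep) : p = q := by
  apply Projectivization.submodule_injective
  rw [Projectivization.submodule_eq, Projectivization.submodule_eq]
  exact span_singleton_eq_of_mem p.rep_nonzero h

theorem span_rep_mk {v : V} (hv : v ≠ 0) : (K ∙ (Projectivization.mk K v hv).rep) = K ∙ v := by
  rw [← Projectivization.submodule_eq, Projectivization.submodule_mk]

theorem exists_mk_eq_iff {v : V} {q : ℙ K V} :
    (∃ h : v ≠ 0, Projectivization.mk K v h = q) ↔ (K ∙ v) = K ∙ q.rep := by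
  constructor
  · rintro ⟨h, rfl⟩
    rw [span_rep_mk]
  · intro h
    have hv : v ≠ 0 := (eq_zero_iff_of_span_singleton_eq h).not.2 q.rep_nonzero
    refine ⟨hv, eq_of_rep_mem_span_singleton ?_⟩
    rw [mem_iff_of_span_singleton_eq (span_rep_mk hv), ← h]
    exact Submodule.mem_span_singleton_self v

theorem indep_range_of_linearIndependent {ι : Type*} {p : ι → ℙ K V}
    (h : LinearIndependent K fun i => (p i).rep) : (projGeometry K V).Indep (Set.range p) := by
  rintro _ ⟨i, rfl⟩ hi
  rw [mem_cl_projGeometry_iff] at hi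
  refine h.notMem_span_image (s := {j | j ≠ i}) (x := i) (by simp) (Submodule.span_mono ?_ hi)
  rintro _ ⟨_, ⟨⟨j, rfl⟩, hj⟩, rfl⟩
  exact ⟨j, fun hji => hj (hji ▸ rfl), rfl⟩

theorem encard_range_of_injective {α : Type*} {m : ℕ} {f : Fin (m + 1) → α}
    (hf : Function.Injective f) : (Set.range f).encard = m + 1 := by
  rw [← Set.image_univ, hf.encard_image, Set.encard_univ]
  simp

theorem hasDim_cl_range {m : ℕ} {p : Fin (m + 1) → ℙ K V}
    (h : LinearIndependent K fun i => (p i).rep) :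
    (projGeometry K V).HasDim ((projGeometry K V).cl (Set.range p)) m :=
  ⟨PointGeometry.cl_mem _ _, _, ⟨indep_range_of_linearIndependent h, rfl⟩,
    encard_range_of_injective (Function.Injective.of_comp (f := Projectivization.rep) h.injective)⟩

variable {X : Set (ℙ K V)}

theorem hasDim_sub_cl_range {m : ℕ} {p : Fin (m + 1) → X}
    (h : LinearIndependent K fun i => (p i).1.rep) :
    ((projGeometry K V).sub X).HasDim (((projGeometry K V).sub X).cl (Set.range p)) m := by
  refine ⟨PointGeometry.cl_mem _ _, _, ⟨PointGeometry.Indep.sub ?_, rfl⟩,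
    encard_range_of_injective (Function.Injective.of_comp (f := fun x : X => x.1.rep) h.injective)⟩
  rw [← Set.range_comp]
  exact indep_range_of_linearIndependent h

theorem mem_cl_sub_range_iff {ι : Type*} {p : ι → X} {q : X} :
    q ∈ ((projGeometry K V).sub X).cl (Set.range p) ↔
      q.1.rep ∈ Submodule.span K (Set.range fun i => (p i).1.rep) := by
  rw [PointGeometry.sub_cl, Set.mem_preimage, mem_cl_projGeometry_iff, ← Set.range_comp,
    ← Set.range_comp]
  rfl

theorem PointGeometry.EnoughPoints.hasPlanePoints
    (hX : ((projGeometry K V).sub X).EnoughPoints) :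
    HasPlanePoints K fun x : X => x.1.rep := by
  intro x y z hxyz
  have hp : (fun i => (![x, y, z] i).1.rep) = ![x.1.rep, y.1.rep, z.1.rep] := by
    ext i; fin_cases i <;> rfl
  have hl : (fun i => (![y, z] i).1.rep) = ![y.1.rep, z.1.rep] := by
    ext i; fin_cases i <;> rfl
  obtain ⟨q, hqP, hqx, hqL⟩ := hX.exists_mem_ne_notMem (hasDim_sub_cl_range (hp ▸ hxyz))
    (hasDim_sub_cl_range (hl ▸ hxyz.comp Fin.succ (Fin.succ_injective 2))) x
  rw [mem_cl_sub_range_iff, hp] at hqP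
  rw [mem_cl_sub_range_iff, hl] at hqL
  refine ⟨q, ?_, fun h => hqx (Subtype.ext (eq_of_rep_mem_span_singleton h)), ?_⟩
  · simpa only [Matrix.range_cons, Matrix.range_empty, Set.union_empty,
      Set.singleton_union] using hqP
  · simpa only [Matrix.range_cons, Matrix.range_empty, Set.union_empty,
      Set.singleton_union] using hqL

theorem isCenter_of_surjective {x : X}
    (hx : Function.Surjective ((projGeometry K V).subQuotMap X x)) :
    IsCenter K (fun x : X => x.1.rep) x := by
  intro v
  by_cases hv : v ∈ K ∙ x.1.rep
  · refine ⟨x, ?_⟩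
    rw [Set.pair_comm, Submodule.span_insert_eq_span hv, Set.pair_eq_singleton]
  · have hv0 : v ≠ 0 := fun h => hv (h ▸ Submodule.zero_mem _)
    have hvx : Projectivization.mk K v hv0 ∉ ({x.1} : Set (ℙ K V)) := fun h => hv (by
      rw [← Set.mem_singleton_iff.1 h, span_rep_mk]
      exact Submodule.mem_span_singleton_self v)
    obtain ⟨y, hy⟩ := hx (Quotient.mk _ ⟨_, hvx⟩)
    induction y using Quotient.inductionOn with
    | h y =>
    have hcl : (projGeometry K V).cl {y.1.1, x.1} =
        (projGeometry K V).cl {Projectivization.mk K v hv0, x.1} := Quotient.exact hy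
    refine ⟨y.1, ?_⟩
    rw [Set.pair_comm, Set.pair_comm x.1.rep, ← span_pair_congr (span_rep_mk hv0) rfl]
    simpa only [Set.image_pair] using (span_rep_image_eq_of_cl_eq hcl).symm

variable {K' V' : Type*} [DivisionRing K'] [AddCommGroup V'] [Module K' V']

theorem PointGeometry.IsMorphism.pullsBackSubmodules_rep {φ : X → ℙ K' V'}
    (hφ : ((projGeometry K V).sub X).IsMorphism (projGeometry K' V') φ) :
    PullsBackSubmodules K K' (fun x : X => x.1.rep) (fun x => (φ x).rep) := by
  intro T
  obtain ⟨S, hS, hφS⟩ := hφ _ (setOf_rep_mem_mem_flats T)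
  obtain ⟨W, hW⟩ := mem_flats_projGeometry_iff.1 hS
  exact ⟨W, fun x => (hW x.1).symm.trans (Set.ext_iff.1 hφS x).symm⟩

theorem PointGeometry.IsEmbedding.pullsBackSubmodules_rep {φ : X → ℙ K' V'}
    (hφ : ((projGeometry K V).sub X).IsEmbedding (projGeometry K' V') φ) :
    PullsBackSubmodules K' K (fun x => (φ x).rep) (fun x : X => x.1.rep) := by
  intro T
  obtain ⟨S, hS, hφS⟩ := (PointGeometry.isEmbedding_iff.1 hφ).2 _
    ⟨_, setOf_rep_mem_mem_flats T, rfl⟩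
  obtain ⟨W, hW⟩ := mem_flats_projGeometry_iff.1 hS
  exact ⟨W, fun x => (hW (φ x)).symm.trans (Set.ext_iff.1 hφS x)⟩

theorem PullsBackSubmodules.congr_left {ι : Type*} {p p' : ι → V} {q : ι → V'}
    (h : PullsBackSubmodules K K' p q) (hp : ∀ i, (K ∙ p' i) = K ∙ p i) :
    PullsBackSubmodules K K' p' q := by
  intro T
  obtain ⟨W, hW⟩ := h T
  exact ⟨W, fun i => (mem_iff_of_span_singleton_eq (hp i)).trans (hW i)⟩

theorem exists_linearIndependent_rep_snoc {α : Type*} {φ : α → ℙ K V} {m : ℕ}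
    (h_image : ∀ S, (projGeometry K V).HasDim S m → ¬ Set.range φ ⊆ S) {y : Fin (m + 1) → α}
    (hy : LinearIndependent K fun i => (φ (y i)).rep) :
    ∃ x, LinearIndependent K fun i => (φ ((Fin.snoc y x : Fin (m + 2) → α) i)).rep := by
  obtain ⟨_, ⟨x, rfl⟩, hx⟩ := Set.not_subset.1 (h_image _ (hasDim_cl_range hy))
  rw [mem_cl_projGeometry_iff, ← Set.range_comp] at hx
  refine ⟨x, ?_⟩
  convert linearIndependent_finSnoc.2 ⟨hy, hx⟩ using 1
  exact Fin.comp_snoc (fun a => (φ a).rep) y x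

theorem exists_linearIndependent_rep_four {α : Type*} {φ : α → ℙ K V}
    (h_image : ∀ (S : Set (ℙ K V)) (n : ℕ), n ≤ 2 → (projGeometry K V).HasDim S n →
      ¬ Set.range φ ⊆ S) {x₁ x₂ : α} (h : φ x₁ ≠ φ x₂) :
    ∃ y : Fin 4 → α, y 0 = x₁ ∧ y 1 = x₂ ∧ LinearIndependent K fun i => (φ (y i)).rep := by
  have pair : LinearIndependent K fun i => (φ (![x₁, x₂] i)).rep := by
    convert Projectivization.linearIndependent_pair_iff_ne.2 h using 1
    ext i
    fin_cases i <;> rfl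
  obtain ⟨x₃, triple⟩ := exists_linearIndependent_rep_snoc (fun S => h_image S 1 (by norm_num)) pair
  obtain ⟨x₄, quadruple⟩ := exists_linearIndependent_rep_snoc (fun S => h_image S 2 le_rfl) triple
  exact ⟨_, rfl, rfl, quadruple⟩

variable {σ τ : K →+* K'} {Φ : V →ₛₗ[σ] V'} {Ψ : V →ₛₗ[τ] V'}

theorem mem_projPartialMap_iff {p : ℙ K V} {q : ℙ K' V'} :
    q ∈ projPartialMap Φ p ↔ (K' ∙ Φ p.rep) = K' ∙ q.rep :=
  exists_mk_eq_iff

theorem projPartialMap_eq_of_eq_smul {a : K'} (ha : a ≠ 0) (h : ∀ v, Ψ v = a • Φ v) :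
    projPartialMap Ψ = projPartialMap Φ := by
  ext p q
  rw [mem_projPartialMap_iff, mem_projPartialMap_iff, h,
    Submodule.span_singleton_smul_eq (IsUnit.mk0 a ha)]

theorem projPartialMap_eq_coe (hΦ : Function.Injective Φ) :
    projPartialMap Φ = (Projectivization.map Φ hΦ : ℙ K V →. ℙ K' V') := by
  ext p q
  induction p using Projectivization.ind with
  | h v hv =>
    rw [mem_projPartialMap_mk, PFun.coe_val, Part.mem_some_iff, Projectivization.map_mk]
    exact ⟨fun ⟨_, h⟩ => h.symm, fun h => ⟨_, h.symm⟩⟩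

theorem projPartialMap_eq_of_isCenter {φ : X → ℙ K' V'} {y : Fin 4 → X}
    (hy₀ : IsCenter K (fun x : X => x.1.rep) (y 0)) (hy₁ : IsCenter K (fun x : X => x.1.rep) (y 1))
    (hy : LinearIndependent K' fun i => (φ (y i)).rep)
    (hΦ : ∀ x : X, φ x ∈ projPartialMap Φ x) (hΨ : ∀ x : X, φ x ∈ projPartialMap Ψ x) :
    projPartialMap Ψ = projPartialMap Φ := by
  simp only [mem_projPartialMap_iff] at hΦ hΨ
  have hΦΨ : ∀ x : X, (K' ∙ Ψ x.1.rep) = K' ∙ Φ x.1.rep := fun x => (hΨ x).trans (hΦ x).symm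
  obtain ⟨a, ha⟩ := exists_eq_smul_of_isCenter (Φ := Φ) (Ψ := Ψ) (y := y ∘ Fin.castSucc) hy₀ hy₁
    (linearIndependent_of_span_singleton_eq (hy.comp _ (Fin.castSucc_injective 3)) fun i => hΦ _)
    fun x => (Submodule.span_singleton_le_iff_mem _ _).1 (hΦΨ x).le
  refine projPartialMap_eq_of_eq_smul ?_ ha
  rintro rfl
  exact (φ (y 0)).rep_nonzero ((eq_zero_iff_of_span_singleton_eq (hΨ (y 0))).1 (by simp [ha]))

theorem injective_of_isCenter {φ : X → ℙ K' V'} {c : X}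
    (hc : IsCenter K (fun x : X => x.1.rep) c) (hφ : Function.Injective φ)
    (hΦ : ∀ x : X, φ x ∈ projPartialMap Φ x) : Function.Injective Φ := by
  simp only [mem_projPartialMap_iff] at hΦ
  refine hc.injective (fun x => (eq_zero_iff_of_span_singleton_eq (hΦ x)).not.2 (φ x).rep_nonzero)
    fun x hx => ?_
  rw [hΦ c, mem_iff_of_span_singleton_eq (hΦ x)] at hx
  rw [hφ (eq_of_rep_mem_span_singleton hx)]
  exact Submodule.mem_span_singleton_self _

theorem rep_map_mem_iff (hΦ : Function.Injective Φ) {p : ℙ K V} {T : Submodule K' V'} :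
    (Projectivization.map Φ hΦ p).rep ∈ T ↔ Φ p.rep ∈ T := by
  conv_lhs => rw [← p.mk_rep, Projectivization.map_mk]
  exact mem_iff_of_span_singleton_eq (span_rep_mk _)

theorem isEmbedding_map (hΦ : Function.Injective Φ)
    (h : ∀ {s : Set V} {v : V}, Φ v ∈ Submodule.span K' (Φ '' s) → v ∈ Submodule.span K s) :
    (projGeometry K V).IsEmbedding (projGeometry K' V') (Projectivization.map Φ hΦ) := by
  refine PointGeometry.isEmbedding_iff.2 ⟨fun S hS => ?_, fun S hS => ?_⟩
  · obtain ⟨T, hT⟩ := mem_flats_projGeometry_iff.1 hS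
    refine mem_flats_projGeometry_iff.2 ⟨T.comap Φ, fun p => ?_⟩
    rw [Set.mem_preimage, hT, rep_map_mem_iff, Submodule.mem_comap]
  · obtain ⟨W, hW⟩ := mem_flats_projGeometry_iff.1 hS
    refine ⟨_, setOf_rep_mem_mem_flats (Submodule.span K' (Φ '' W)), Set.ext fun p => ?_⟩
    rw [Set.mem_preimage, Set.mem_ofPred_eq, rep_map_mem_iff, hW]
    exact ⟨fun hp => W.span_eq ▸ h hp, fun hp => Submodule.subset_span ⟨_, hp, rfl⟩⟩

theorem isEmbedding_map_of_isCenter {φ : X → ℙ K' V'} {c : X}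
    (hc : IsCenter K (fun x : X => x.1.rep) c)
    (hφ : ((projGeometry K V).sub X).IsEmbedding (projGeometry K' V') φ)
    (hΦ : ∀ x : X, φ x ∈ projPartialMap Φ x) (hΦ_inj : Function.Injective Φ) :
    (projGeometry K V).IsEmbedding (projGeometry K' V') (Projectivization.map Φ hΦ_inj) :=
  isEmbedding_map hΦ_inj <| hc.mem_of_map_mem_span <|
    hφ.pullsBackSubmodules_rep.congr_left fun x => mem_projPartialMap_iff.1 (hΦ x)

end Geometry

theorem mainTheorem6 {K V K' V' : Type*}
    [DivisionRing K] [AddCommGroup V] [Module K V]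
    [DivisionRing K'] [AddCommGroup V'] [Module K' V']
    (X : Set (ℙ K V)) (hX : ((projGeometry K V).sub X).EnoughPoints)
    (φ : X → ℙ K' V')
    (hφ : ((projGeometry K V).sub X).IsMorphism (projGeometry K' V') φ)
    (h_image : ∀ (S : Set (ℙ K' V')) (n : ℕ), n ≤ 2 → (projGeometry K' V').HasDim S n →
      ¬ Set.range φ ⊆ S)
    (h_points : ∃ x₁ x₂ : X,
      Function.Surjective ((projGeometry K V).subQuotMap X x₁) ∧
      Function.Surjective ((projGeometry K V).subQuotMap X x₂) ∧
      φ x₁ ≠ φ x₂) :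
    ∃ ϕ : ℙ K V →. ℙ K' V',
      (IsPartialProjective ϕ ∧ ∀ x : X, φ x ∈ ϕ x) ∧
      (∀ ψ : ℙ K V →. ℙ K' V', IsPartialProjective ψ → (∀ x : X, φ x ∈ ψ x) → ψ = ϕ) ∧
      (Function.Injective φ → ϕ.Dom = Set.univ) ∧
      (((projGeometry K V).sub X).IsEmbedding (projGeometry K' V') φ →
        ∃ f : ℙ K V → ℙ K' V', ϕ = (f : ℙ K V →. ℙ K' V') ∧
          (projGeometry K V).IsEmbedding (projGeometry K' V') f) := by
  obtain ⟨x₁, x₂, hx₁, hx₂, hne⟩ := h_points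
  obtain ⟨y, rfl, rfl, hy⟩ := exists_linearIndependent_rep_four h_image hne
  have hc₁ := isCenter_of_surjective hx₁
  have hc₂ := isCenter_of_surjective hx₂
  obtain ⟨σ, Φ, hΦ_span⟩ := exists_semilinearMap_of_isCenter hc₁ hc₂ hX.hasPlanePoints
    (fun x => (φ x).rep_nonzero) hφ.pullsBackSubmodules_rep hy
  have hΦ : ∀ x : X, φ x ∈ projPartialMap Φ x := fun x => mem_projPartialMap_iff.2 (hΦ_span x)
  have hΦ_inj : Function.Injective φ → Function.Injective Φ := fun hφ_inj =>
    injective_of_isCenter hc₁ hφ_inj hΦ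
  refine ⟨projPartialMap Φ, ⟨⟨σ, Φ, rfl⟩, hΦ⟩, ?_, ?_, ?_⟩
  · rintro _ ⟨τ, Ψ, rfl⟩ hΨ
    exact projPartialMap_eq_of_isCenter hc₁ hc₂ hy hΦ hΨ
  · intro hφ_inj
    rw [projPartialMap_eq_coe (hΦ_inj hφ_inj)]
    rfl
  · intro hφ_emb
    exact ⟨_, projPartialMap_eq_coe (hΦ_inj hφ_emb.injective),
      isEmbedding_map_of_isCenter hc₁ hφ_emb hΦ _⟩
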